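/- Let $E$ be a complex Banach lattice, i.e. the complexification $E = E_{\mathbb R} \oplus iE_{\mathbb R}$ of a real Banach lattice $E_{\mathbb R}$, with modulus $|x+iy| = \sup_{\theta\in\mathbb R}\big((\cos\theta)x+(\sin\theta)y\big)$ and norm $\|z\| = \|\,|z|\,\|$. Let $T\colon E\to E$ be a bounded linear operator which is positive, i.e. $Tx\ge 0$ for every $x \in E_{\mathbb R}$ with $x\ge 0$. Let $\sigma(T)$ denote the spectrum, $r(T)$ the spectral radius, $R(\mu,T)=(\mu-T)^{-1}$ the resolvent, and $\sigma_{\mathrm{per}}(T)=\{\mu\in\sigma(T) : |\mu|=r(T)\}$ the peripheral spectrum of $T$. Assume that $r(T)=1$ and that $\lambda\in\sigma_{\mathrm{per}}(T)$ is a pole of the resolvent $R(\,\cdot\,,T)$. If there is a decreasing sequence $(r_n)$ of real numbers $r_n>1$ with $r_n\to 1$ such that $$\|R(r_n,T)\| = O\Big(\frac{1}{(r_n-1)^2}\Big) \quad (n\to\infty),$$ then $\lambda^k\in\sigma_{\mathrm{per}}(T)$ for all $k\in\mathbb Z$. -/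

import Mathlib

open Filter Topology Asymptotics
open scoped ENNReal NNReal

/-- The complexification `E ⊕ iE` of a real vector space `E`; `⟨x, y⟩` stands for `x + i y`. -/
@[ext]
structure Complexification (E : Type*) where
  re : E
  im : E

namespace Complexification

variable {E : Type*}

section Algebra

variable [AddCommGroup E]

instance : Zero (Complexification E) := ⟨⟨0, 0⟩⟩
instance : Add (Complexification E) := ⟨fun z w => ⟨z.re + w.re, z.im + w.im⟩⟩
instance : Neg (Complexification E) := ⟨fun z => ⟨-z.re, -z.im⟩⟩
instance : Sub (Complexification E) := ⟨fun z w => ⟨z.re - w.re, z.im - w.im⟩⟩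

@[simp] theorem zero_re : (0 : Complexification E).re = 0 := rfl
@[simp] theorem zero_im : (0 : Complexification E).im = 0 := rfl
@[simp] theorem add_re (z w : Complexification E) : (z + w).re = z.re + w.re := rfl
@[simp] theorem add_im (z w : Complexification E) : (z + w).im = z.im + w.im := rfl
@[simp] theorem neg_re (z : Complexification E) : (-z).re = -z.re := rfl
@[simp] theorem neg_im (z : Complexification E) : (-z).im = -z.im := rfl
@[simp] theorem sub_re (z w : Complexification E) : (z - w).re = z.re - w.re := rfl
@[simp] theorem sub_im (z w : Complexification E) : (z - w).im = z.im - w.im := rfl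

instance : AddCommGroup (Complexification E) where
  add_assoc a b c := by ext <;> simp [add_assoc]
  zero_add a := by ext <;> simp
  add_zero a := by ext <;> simp
  neg_add_cancel a := by ext <;> simp
  add_comm a b := by ext <;> simp [add_comm]
  sub_eq_add_neg a b := by ext <;> simp [sub_eq_add_neg]
  nsmul := nsmulRec
  zsmul := zsmulRec

variable [Module ℝ E]

/-- `(a + i b) (x + i y) = (a x - b y) + i (a y + b x)`. -/
instance : SMul ℂ (Complexification E) :=
  ⟨fun c z => ⟨c.re • z.re - c.im • z.im, c.re • z.im + c.im • z.re⟩⟩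

@[simp] theorem smul_re (c : ℂ) (z : Complexification E) :
    (c • z).re = c.re • z.re - c.im • z.im := rfl
@[simp] theorem smul_im (c : ℂ) (z : Complexification E) :
    (c • z).im = c.re • z.im + c.im • z.re := rfl

instance : Module ℂ (Complexification E) where
  one_smul z := by ext <;> simp
  mul_smul a b z := by
    ext
    · simp only [smul_re, smul_im, Complex.mul_re, Complex.mul_im]; module
    · simp only [smul_re, smul_im, Complex.mul_re, Complex.mul_im]; module
  smul_zero a := by ext <;> simp
  zero_smul z := by ext <;> simp
  smul_add a z w := by
    ext
    · simp only [smul_re, add_re, add_im]; module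
    · simp only [smul_im, add_re, add_im]; module
  add_smul a b z := by
    ext
    · simp only [smul_re, add_re, Complex.add_re, Complex.add_im]; module
    · simp only [smul_im, add_im, Complex.add_re, Complex.add_im]; module

end Algebra

section Modulus

variable [NormedAddCommGroup E] [Lattice E] [HasSolidNorm E] [IsOrderedAddMonoid E]
  [NormedSpace ℝ E] [IsOrderedModule ℝ E] [CompleteSpace E]

/-- The real part of `e^{-iθ} z`. -/
noncomputable def rot (z : Complexification E) (θ : ℝ) : E :=
  Real.cos θ • z.re + Real.sin θ • z.im

theorem exists_net (δ : ℝ) (hδ : 0 < δ) : ∃ F : Finset ℝ, F.Nonempty ∧ ∀ θ : ℝ, ∃ φ ∈ F,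
    |Real.cos θ - Real.cos φ| ≤ δ ∧ |Real.sin θ - Real.sin φ| ≤ δ := by
  obtain ⟨t, -, ht, hcov⟩ := Metric.totallyBounded_iff.1
    (isCompact_Icc (a := (0 : ℝ)) (b := 2 * Real.pi)).totallyBounded δ hδ |>.imp
      (fun t h => And.intro trivial h)
  have key : ∀ θ : ℝ, ∃ φ ∈ ht.toFinset,
      |Real.cos θ - Real.cos φ| ≤ δ ∧ |Real.sin θ - Real.sin φ| ≤ δ := by
    intro θ
    obtain ⟨ψ, hψ, hc, hs⟩ : ∃ ψ ∈ Set.Icc (0 : ℝ) (2 * Real.pi),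
        Real.cos ψ = Real.cos θ ∧ Real.sin ψ = Real.sin θ := by
      refine ⟨toIcoMod Real.two_pi_pos 0 θ, ?_, ?_, ?_⟩
      · have h := toIcoMod_mem_Ico Real.two_pi_pos 0 θ
        rw [zero_add] at h
        exact ⟨h.1, h.2.le⟩
      · rw [toIcoMod, zsmul_eq_mul, Real.cos_sub_int_mul_two_pi]
      · rw [toIcoMod, zsmul_eq_mul, Real.sin_sub_int_mul_two_pi]
    obtain ⟨φ, hφ, hd⟩ := Set.mem_iUnion₂.1 (hcov hψ)
    rw [Metric.mem_ball, Real.dist_eq] at hd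
    refine ⟨φ, by simpa using hφ, ?_, ?_⟩
    · rw [← hc]; exact (Real.abs_cos_sub_cos_le ψ φ).trans hd.le
    · rw [← hs]; exact (Real.abs_sin_sub_sin_le ψ φ).trans hd.le
  obtain ⟨φ, hφ, -⟩ := key 0
  exact ⟨ht.toFinset, ⟨φ, hφ⟩, key⟩

theorem abs_smul_le (a : ℝ) (x : E) : |a • x| ≤ |a| • |x| := by
  rcases le_total 0 a with ha | ha
  · rw [abs_of_nonneg ha]
    refine abs_le'.2 ⟨smul_le_smul_of_nonneg_left (le_abs_self x) ha, ?_⟩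
    rw [← smul_neg]
    exact smul_le_smul_of_nonneg_left (neg_le_abs x) ha
  · have ha' : 0 ≤ -a := neg_nonneg.2 ha
    rw [abs_of_nonpos ha]
    refine abs_le'.2 ⟨?_, ?_⟩
    · rw [← neg_smul_neg a x]
      exact smul_le_smul_of_nonneg_left (neg_le_abs x) ha'
    · rw [← neg_smul]
      exact smul_le_smul_of_nonneg_left (le_abs_self x) ha'

theorem rot_le_rot_add (z : Complexification E) {δ θ φ : ℝ}
    (hc : |Real.cos θ - Real.cos φ| ≤ δ) (hs : |Real.sin θ - Real.sin φ| ≤ δ) :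
    rot z θ ≤ rot z φ + δ • (|z.re| + |z.im|) := by
  have h1 : (Real.cos θ - Real.cos φ) • z.re ≤ δ • |z.re| :=
    (le_abs_self _).trans ((abs_smul_le _ _).trans
      <| smul_le_smul_of_nonneg_right hc (abs_nonneg _))
  have h2 : (Real.sin θ - Real.sin φ) • z.im ≤ δ • |z.im| :=
    (le_abs_self _).trans ((abs_smul_le _ _).trans
      <| smul_le_smul_of_nonneg_right hs (abs_nonneg _))
  have h3 : rot z θ = rot z φ +
      ((Real.cos θ - Real.cos φ) • z.re + (Real.sin θ - Real.sin φ) • z.im) := by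
    simp only [rot]; module
  rw [h3, smul_add]
  gcongr

/-- In a real Banach lattice the supremum of `(cos θ) x + (sin θ) y` over all `θ` exists. -/
theorem exists_isLUB_rot (z : Complexification E) : ∃ m : E, IsLUB (Set.range (rot z)) m := by
  have hpos : ∀ n : ℕ, (0 : ℝ) < 1 / ((n : ℝ) + 1) := fun n => by positivity
  choose F hF hnet using fun n : ℕ => exists_net (1 / ((n : ℝ) + 1)) (hpos n)
  set u : E := |z.re| + |z.im| with hu
  have hu0 : 0 ≤ u := add_nonneg (abs_nonneg _) (abs_nonneg _)
  set m : ℕ → E := fun n => (F n).sup' (hF n) (rot z) with hm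
  have h1 : ∀ n θ, rot z θ ≤ m n + (1 / ((n : ℝ) + 1)) • u := by
    intro n θ
    obtain ⟨φ, hφ, hc, hs⟩ := hnet n θ
    refine (rot_le_rot_add z hc hs).trans ?_
    gcongr
    exact Finset.le_sup' (rot z) hφ
  have h2 : ∀ p n, m p ≤ m n + (1 / ((n : ℝ) + 1)) • u :=
    fun p n => Finset.sup'_le _ _ fun θ _ => h1 n θ
  have hcau : CauchySeq m := by
    refine cauchySeq_of_le_tendsto_0 (fun N : ℕ => (1 / ((N : ℝ) + 1)) * ‖u‖) ?_ ?_
    · intro n p N hn hp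
      rw [dist_eq_norm]
      have hle : ∀ q r : ℕ, N ≤ r → m q - m r ≤ (1 / ((N : ℝ) + 1)) • u := by
        intro q r hr
        rw [sub_le_iff_le_add']
        refine (h2 q r).trans ?_
        gcongr
      have habs : |m n - m p| ≤ |(1 / ((N : ℝ) + 1)) • u| := by
        rw [abs_of_nonneg (smul_nonneg (hpos N).le hu0)]
        exact abs_le'.2 ⟨hle n p hp, by rw [neg_sub]; exact hle p n hn⟩
      refine (norm_le_norm_of_abs_le_abs habs).trans ?_
      rw [norm_smul, Real.norm_of_nonneg (hpos N).le]
    · simpa using (tendsto_one_div_add_atTop_nhds_zero_nat (𝕜 := ℝ)).mul_const ‖u‖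
  obtain ⟨l, hl⟩ := cauchySeq_tendsto_of_complete hcau
  refine ⟨l, ?_, ?_⟩
  · rintro _ ⟨θ, rfl⟩
    have hlim : Tendsto (fun n : ℕ => m n + (1 / ((n : ℝ) + 1)) • u) atTop (𝓝 l) := by
      simpa using hl.add
        ((tendsto_one_div_add_atTop_nhds_zero_nat (𝕜 := ℝ)).smul_const u)
    exact ge_of_tendsto' hlim fun n => h1 n θ
  · intro b hb
    exact le_of_tendsto' hl fun n => Finset.sup'_le _ _ fun θ _ => hb ⟨θ, rfl⟩

/-- The modulus `|x + i y| = sup_θ ((cos θ) x + (sin θ) y)`. -/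
noncomputable def modulus (z : Complexification E) : E := (exists_isLUB_rot z).choose

theorem isLUB_modulus (z : Complexification E) : IsLUB (Set.range (rot z)) (modulus z) :=
  (exists_isLUB_rot z).choose_spec

theorem rot_le_modulus (z : Complexification E) (θ : ℝ) : rot z θ ≤ modulus z :=
  (isLUB_modulus z).1 ⟨θ, rfl⟩

theorem modulus_le {z : Complexification E} {b : E} (h : ∀ θ, rot z θ ≤ b) : modulus z ≤ b :=
  (isLUB_modulus z).2 (by rintro _ ⟨θ, rfl⟩; exact h θ)

theorem abs_re_le_modulus (z : Complexification E) : |z.re| ≤ modulus z :=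
  abs_le'.2 ⟨by simpa [rot] using rot_le_modulus z 0,
    by simpa [rot] using rot_le_modulus z Real.pi⟩

theorem abs_im_le_modulus (z : Complexification E) : |z.im| ≤ modulus z :=
  abs_le'.2 ⟨by simpa [rot] using rot_le_modulus z (Real.pi / 2),
    by simpa [rot] using rot_le_modulus z (-(Real.pi / 2))⟩

theorem modulus_nonneg (z : Complexification E) : 0 ≤ modulus z :=
  (abs_nonneg _).trans (abs_re_le_modulus z)

theorem modulus_le_abs_add_abs (z : Complexification E) : modulus z ≤ |z.re| + |z.im| := by
  refine modulus_le fun θ => add_le_add ?_ ?_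
  · refine (le_abs_self _).trans ((abs_smul_le _ _).trans ?_)
    simpa using smul_le_smul_of_nonneg_right (Real.abs_cos_le_one θ) (abs_nonneg z.re)
  · refine (le_abs_self _).trans ((abs_smul_le _ _).trans ?_)
    simpa using smul_le_smul_of_nonneg_right (Real.abs_sin_le_one θ) (abs_nonneg z.im)

theorem modulus_add_le (z w : Complexification E) :
    modulus (z + w) ≤ modulus z + modulus w := by
  refine modulus_le fun θ => ?_
  have h : rot (z + w) θ = rot z θ + rot w θ := by simp only [rot, add_re, add_im]; module
  rw [h]
  exact add_le_add (rot_le_modulus z θ) (rot_le_modulus w θ)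

theorem modulus_smul_le (c : ℂ) (z : Complexification E) :
    modulus (c • z) ≤ ‖c‖ • modulus z := by
  refine modulus_le fun θ => ?_
  have h : rot (c • z) θ = ‖c‖ • rot z (θ - c.arg) := by
    simp only [rot, smul_re, smul_im, Real.cos_sub, Real.sin_sub]
    rw [← Complex.norm_mul_cos_arg c, ← Complex.norm_mul_sin_arg c]
    module
  rw [h]
  exact smul_le_smul_of_nonneg_left (rot_le_modulus z _) (norm_nonneg c)

/-- The norm `‖z‖ = ‖ |z| ‖` of the complexification of a real Banach lattice. -/
noncomputable instance : Norm (Complexification E) := ⟨fun z => ‖modulus z‖⟩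

theorem norm_def (z : Complexification E) : ‖z‖ = ‖modulus z‖ := rfl

theorem norm_le_norm_of_nonneg_of_le {a b : E} (ha : 0 ≤ a) (h : a ≤ b) : ‖a‖ ≤ ‖b‖ :=
  norm_le_norm_of_abs_le_abs (by rwa [abs_of_nonneg ha, abs_of_nonneg (ha.trans h)])

theorem norm_re_le (z : Complexification E) : ‖z.re‖ ≤ ‖z‖ := by
  rw [norm_def, ← norm_abs_eq_norm z.re]
  exact norm_le_norm_of_nonneg_of_le (abs_nonneg _) (abs_re_le_modulus z)

theorem norm_im_le (z : Complexification E) : ‖z.im‖ ≤ ‖z‖ := by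
  rw [norm_def, ← norm_abs_eq_norm z.im]
  exact norm_le_norm_of_nonneg_of_le (abs_nonneg _) (abs_im_le_modulus z)

theorem norm_le_re_add_im (z : Complexification E) : ‖z‖ ≤ ‖z.re‖ + ‖z.im‖ := by
  rw [norm_def, ← norm_abs_eq_norm z.re, ← norm_abs_eq_norm z.im]
  exact (norm_le_norm_of_nonneg_of_le (modulus_nonneg z) (modulus_le_abs_add_abs z)).trans (norm_add_le _ _)

theorem norm_smul_le' (c : ℂ) (z : Complexification E) : ‖c • z‖ ≤ ‖c‖ * ‖z‖ := by
  have h := norm_le_norm_of_nonneg_of_le (modulus_nonneg _) (modulus_smul_le c z)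
  rwa [norm_smul, norm_norm] at h

theorem core : NormedSpace.Core ℂ (Complexification E) where
  norm_nonneg z := norm_nonneg (modulus z)
  norm_smul c z := by
    refine (norm_smul_le' c z).antisymm ?_
    rcases eq_or_ne c 0 with rfl | hc
    · rw [norm_zero, zero_mul]; exact norm_nonneg (modulus ((0 : ℂ) • z))
    · have h := norm_smul_le' c⁻¹ (c • z)
      rw [smul_smul, inv_mul_cancel₀ hc, one_smul, norm_inv] at h
      have hc' : 0 < ‖c‖ := norm_pos_iff.2 hc
      calc ‖c‖ * ‖z‖ ≤ ‖c‖ * (‖c‖⁻¹ * ‖c • z‖) := by gcongr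
        _ = ‖c • z‖ := by rw [← mul_assoc, mul_inv_cancel₀ hc'.ne', one_mul]
  norm_triangle z w :=
    (norm_le_norm_of_nonneg_of_le (modulus_nonneg _) (modulus_add_le z w)).trans (norm_add_le _ _)
  norm_eq_zero_iff z := by
    constructor
    · intro h
      have h1 := norm_re_le z
      have h2 := norm_im_le z
      rw [h] at h1 h2
      ext
      · exact norm_le_zero_iff.1 h1
      · exact norm_le_zero_iff.1 h2
    · rintro rfl
      refine le_antisymm ?_ (norm_nonneg (modulus (0 : Complexification E)))
      simpa using norm_le_re_add_im (0 : Complexification E)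

noncomputable instance : NormedAddCommGroup (Complexification E) := NormedAddCommGroup.ofCore core

noncomputable instance : NormedSpace ℂ (Complexification E) := NormedSpace.ofCore core

theorem dist_re_le (z w : Complexification E) : dist z.re w.re ≤ dist z w := by
  rw [dist_eq_norm, dist_eq_norm]
  exact norm_re_le (z - w)

theorem dist_im_le (z w : Complexification E) : dist z.im w.im ≤ dist z w := by
  rw [dist_eq_norm, dist_eq_norm]
  exact norm_im_le (z - w)

theorem dist_le_re_add_im (z w : Complexification E) :
    dist z w ≤ dist z.re w.re + dist z.im w.im := by
  rw [dist_eq_norm, dist_eq_norm, dist_eq_norm]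
  exact norm_le_re_add_im (z - w)

theorem exists_tendsto_of_cauchySeq {s : ℕ → Complexification E} (hs : CauchySeq s) :
    ∃ z, Tendsto s atTop (𝓝 z) := by
  rw [Metric.cauchySeq_iff] at hs
  have h1 : CauchySeq fun n => (s n).re := Metric.cauchySeq_iff.2 fun ε hε =>
    (hs ε hε).imp fun N hN m hm n hn => (dist_re_le _ _).trans_lt (hN m hm n hn)
  have h2 : CauchySeq fun n => (s n).im := Metric.cauchySeq_iff.2 fun ε hε =>
    (hs ε hε).imp fun N hN m hm n hn => (dist_im_le _ _).trans_lt (hN m hm n hn)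
  obtain ⟨x, hx⟩ := cauchySeq_tendsto_of_complete h1
  obtain ⟨y, hy⟩ := cauchySeq_tendsto_of_complete h2
  refine ⟨⟨x, y⟩, ?_⟩
  rw [tendsto_iff_dist_tendsto_zero] at hx hy ⊢
  exact squeeze_zero (fun n => dist_nonneg) (fun n => dist_le_re_add_im (s n) ⟨x, y⟩)
    (by simpa using hx.add hy)

instance : CompleteSpace (Complexification E) :=
  Metric.complete_of_cauchySeq_tendsto fun _ => exists_tendsto_of_cauchySeq

/-- The positive cone of `E ⊕ iE`: real elements `x + i 0` with `0 ≤ x`. -/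
def positiveCone (E : Type*) [AddCommGroup E] [Lattice E] : Set (Complexification E) :=
  {z | 0 ≤ z.re ∧ z.im = 0}

/-- A bounded operator is positive if it maps the positive cone into itself. -/
def IsPositiveOperator (T : Complexification E →L[ℂ] Complexification E) : Prop :=
  Set.MapsTo T (positiveCone E) (positiveCone E)

end Modulus

end Complexification

section Spectral

variable {X : Type*} [NormedAddCommGroup X] [NormedSpace ℂ X]

/-- The peripheral spectrum: the spectral values `μ` with `|μ| = r(T)`. -/
def peripheralSpectrum (T : X →L[ℂ] X) : Set ℂ :=
  {μ | μ ∈ spectrum ℂ T ∧ (‖μ‖₊ : ℝ≥0∞) = spectralRadius ℂ T}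

/-- `μ` is a pole of the resolvent `R(·, T) = (· - T)⁻¹`: the resolvent is defined on a punctured
neighbourhood of `μ`, and is meromorphic at `μ` with negative order. -/
def IsPoleOfResolvent (T : X →L[ℂ] X) (μ : ℂ) : Prop :=
  (∀ᶠ w in 𝓝[≠] μ, w ∈ resolventSet ℂ T) ∧ MeromorphicAt (resolvent T) μ ∧
    meromorphicOrderAt (resolvent T) μ < 0

end Spectral

/-! Write `S = realPart T`, so that `T` is the complexification of `S`. If `T z = λ z` and `S |z| =
|z|`, the natural eigenvector for `λ ^ k` is `|z| (sgn z)^k`. No multiplication is at hand in a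
Banach lattice, so this product is replaced by `v = ∫ e^{ikθ} w_θ dθ`, where the bump `w_θ =
(Re(e^{-iθ} z) - c |z|)⁺` lives where the phase of `z` is near `θ`.

The argument works modulo a closed `S`-invariant ideal `N`. Suppose `T z ≡ λ z`, `|z| ∉ N`, and
every `y` with `0 ≤ y ≤ C |z|` and `y ≤ S y` mod `N` satisfies `S y ≡ y`. Then `T v ≡ λ ^ k v`. If
`λ ^ k` were in the resolvent set, `v` would lie in the complexification of `N`, hence so would all
bumps, hence `|z| ∈ N`, a contradiction (`IsPositiveOperator.zpow_mem_spectrum`).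

Such an ideal is the null ideal of a gauge `q` with `q ≤ q ∘ S`: if `q` is bounded on the orbit of
`|z|`, telescoping makes increasing orbits below `C |z|` constant mod `N`
(`IsGauge.zpow_mem_spectrum`). It remains to find `z` and `q` with `q |z| ≠ 0`.

The growth hypothesis enters twice. The domination `|R(μ) x| ≤ R(|μ|) |x|` bounds the order of the
pole by two. Moreover, for a positive functional `χ`, weak* cluster points `ψ` of `(s_n - 1)²
R(s_n)' χ` exist and are `S`-invariant. For a pole of order two, `q = ψ` works with `z` taken from
the second Laurent coefficient. For a pole of order one, let `z` be an eigenvector in the range of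
the residue and `q` the modulus of an eigenfunctional. Either `q` is bounded on the orbit of `|z|`,
or `q` grows linearly along it; in the latter case the resolvent has quadratic growth on `|z|`, so
that a suitable `ψ` has `ψ |z| > 0` and serves as the gauge. -/

set_option linter.unusedSectionVars false

/-! ### Neumann series of the resolvent -/

/-- The Neumann series of the resolvent outside the spectral disc. -/
theorem hasSum_resolvent_of_spectralRadius_lt {A : Type*} [NormedRing A] [NormedAlgebra ℂ A]
    [CompleteSpace A] (a : A) {μ : ℂ} (hμ : spectralRadius ℂ a < ‖μ‖₊) :
    HasSum (fun n : ℕ => (μ⁻¹) ^ (n + 1) • a ^ n) (resolvent a μ) := by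
  have hμ0 : μ ≠ 0 := by
    rintro rfl
    simp at hμ
  have hlt : (‖μ⁻¹‖₊ : ℝ≥0∞) < (spectralRadius ℂ a)⁻¹ := by
    rw [nnnorm_inv, ENNReal.coe_inv (nnnorm_ne_zero_iff.2 hμ0)]
    exact ENNReal.inv_lt_inv.2 hμ
  obtain ⟨r, hr1, hr2⟩ := ENNReal.lt_iff_exists_nnreal_btwn.1 hlt
  have hr0 : 0 < r := (zero_le (a := ‖μ⁻¹‖₊)).trans_lt (ENNReal.coe_lt_coe.1 hr1)
  have H := (spectrum.hasFPowerSeriesOnBall_inverse_one_sub_smul ℂ a).exchange_radius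
    ((spectrum.differentiableOn_inverse_one_sub_smul hr2).hasFPowerSeriesOnBall hr0)
  have hs := H.hasSum (y := μ⁻¹) (by
    rw [Metric.mem_eball, edist_zero_right, enorm_eq_nnnorm]
    exact hr1)
  have hres : resolvent a μ = μ⁻¹ • Ring.inverse (1 - μ⁻¹ • a) := by
    have h := spectrum.units_smul_resolvent_self (r := Units.mk0 μ hμ0) (a := a)
    have h2 : resolvent ((Units.mk0 μ hμ0)⁻¹ • a) (1 : ℂ) = Ring.inverse (1 - μ⁻¹ • a) := by
      simp [resolvent, Units.smul_def]
    rw [← h2, ← h, Units.smul_def, Units.val_mk0, smul_smul, inv_mul_cancel₀ hμ0, one_smul]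
  rw [hres]
  have hs' : HasSum (fun n : ℕ => μ⁻¹ ^ n • a ^ n) (Ring.inverse (1 - μ⁻¹ • a)) := by
    simpa using hs
  simpa [smul_smul, pow_succ'] using hs'.const_smul μ⁻¹

theorem hasSum_resolvent_apply {X : Type*} [NormedAddCommGroup X] [NormedSpace ℂ X]
    [CompleteSpace X] (T : X →L[ℂ] X) {μ : ℂ} (hμ : spectralRadius ℂ T < ‖μ‖₊) (x : X) :
    HasSum (fun n : ℕ => (μ⁻¹) ^ (n + 1) • (T ^ n) x) (resolvent T μ x) :=
  (hasSum_resolvent_of_spectralRadius_lt T hμ).mapL (ContinuousLinearMap.apply ℂ X x)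

/-! ### Positive operators and domination of the resolvent -/

namespace Complexification

variable {E : Type*} [NormedAddCommGroup E] [Lattice E] [HasSolidNorm E] [IsOrderedAddMonoid E]
  [NormedSpace ℝ E] [IsOrderedModule ℝ E] [CompleteSpace E]

/-- The real part as a bounded additive map. -/
noncomputable def reL : Complexification E →+ E where
  toFun := re
  map_zero' := rfl
  map_add' _ _ := rfl

theorem continuous_re : Continuous (re : Complexification E → E) :=
  (LipschitzWith.of_dist_le_mul (K := 1) fun z w => by simpa using dist_re_le z w).continuous

theorem continuous_im : Continuous (im : Complexification E → E) :=
  (LipschitzWith.of_dist_le_mul (K := 1) fun z w => by simpa using dist_im_le z w).continuous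

theorem continuous_rot (z : Complexification E) : Continuous (rot z) :=
  (Real.continuous_cos.smul continuous_const).add (Real.continuous_sin.smul continuous_const)

theorem ofReal_smul_eq (c : ℝ) (z : Complexification E) :
    (c : ℂ) • z = ⟨c • z.re, c • z.im⟩ := by
  ext <;> simp only [smul_re, smul_im, Complex.ofReal_re, Complex.ofReal_im] <;> module

theorem rot_add (z w : Complexification E) (θ : ℝ) : rot (z + w) θ = rot z θ + rot w θ := by
  simp only [rot, add_re, add_im]; module

theorem rot_add_pi (z : Complexification E) (θ : ℝ) : rot z (θ + Real.pi) = -rot z θ := by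
  simp only [rot, Real.cos_add_pi, Real.sin_add_pi]; module

theorem rot_periodic (z : Complexification E) : Function.Periodic (rot z) (2 * Real.pi) := by
  intro θ
  simp only [rot, Real.cos_add_two_pi, Real.sin_add_two_pi]

theorem abs_rot_le_modulus (z : Complexification E) (θ : ℝ) : |rot z θ| ≤ modulus z :=
  abs_le'.2 ⟨rot_le_modulus z θ, by rw [← rot_add_pi]; exact rot_le_modulus z _⟩

/-- Rotation by a unimodular scalar shifts the angle. -/
theorem rot_smul_exp (z : Complexification E) (α θ : ℝ) :
    rot (Complex.exp (α * Complex.I) • z) θ = rot z (θ - α) := by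
  simp only [rot, smul_re, smul_im, Real.cos_sub, Real.sin_sub, Complex.exp_ofReal_mul_I_re,
    Complex.exp_ofReal_mul_I_im]
  module

theorem modulus_neg (z : Complexification E) : modulus (-z) = modulus z := by
  have h : ∀ w : Complexification E, modulus (-w) ≤ modulus w := fun w => by
    simpa using modulus_smul_le (-1 : ℂ) w
  exact (h z).antisymm (by simpa using h (-z))

theorem modulus_ofReal (x : E) : modulus (⟨x, 0⟩ : Complexification E) = |x| :=
  le_antisymm (by simpa using modulus_le_abs_add_abs (⟨x, 0⟩ : Complexification E))
    (abs_re_le_modulus ⟨x, 0⟩)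

theorem norm_ofReal (x : E) : ‖(⟨x, 0⟩ : Complexification E)‖ = ‖x‖ := by
  rw [norm_def, modulus_ofReal, norm_abs_eq_norm]

theorem norm_modulus (z : Complexification E) : ‖modulus z‖ = ‖z‖ := rfl

theorem continuous_modulus : Continuous (modulus : Complexification E → E) := by
  refine (LipschitzWith.of_dist_le_mul (K := 1) fun z w => ?_).continuous
  have key : ∀ z w : Complexification E, modulus z - modulus w ≤ modulus (z - w) := fun z w => by
    simpa [sub_le_iff_le_add] using modulus_add_le (z - w) w
  rw [NNReal.coe_one, one_mul, dist_eq_norm, dist_eq_norm, norm_def]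
  refine norm_le_norm_of_abs_le_abs ?_
  rw [abs_of_nonneg (modulus_nonneg _)]
  refine abs_le'.2 ⟨key z w, ?_⟩
  rw [neg_sub, ← modulus_neg (z - w), neg_sub]
  exact key w z

theorem modulus_ne_zero {z : Complexification E} (hz : z ≠ 0) : modulus z ≠ 0 := by
  intro h
  rw [← norm_ne_zero_iff, norm_def, h, norm_zero] at hz
  exact hz rfl

/-- The restriction of an operator to the real part, followed by the projection onto the real
part. -/
noncomputable def realPart (T : Complexification E →L[ℂ] Complexification E) : E →L[ℝ] E :=
  LinearMap.mkContinuous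
    { toFun := fun x => (T ⟨x, 0⟩).re
      map_add' := fun x y => by
        rw [← add_re, ← map_add]
        congr 2
        ext <;> simp
      map_smul' := fun c x => by
        rw [show (⟨c • x, 0⟩ : Complexification E) = (c : ℂ) • ⟨x, 0⟩ by
          rw [ofReal_smul_eq, smul_zero],
          map_smul, ofReal_smul_eq]
        rfl } ‖T‖ fun x =>
    (norm_re_le _).trans ((T.le_opNorm _).trans_eq (by rw [norm_ofReal]))

theorem realPart_apply (T : Complexification E →L[ℂ] Complexification E) (x : E) :
    realPart T x = (T ⟨x, 0⟩).re := rfl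

theorem norm_realPart_le (T : Complexification E →L[ℂ] Complexification E) :
    ‖realPart T‖ ≤ ‖T‖ :=
  LinearMap.mkContinuous_norm_le _ (norm_nonneg _) _

section Positive

variable {T : Complexification E →L[ℂ] Complexification E}

theorem IsPositiveOperator.realPart_nonneg (hT : IsPositiveOperator T) {x : E} (hx : 0 ≤ x) :
    0 ≤ realPart T x :=
  (hT (show (⟨x, 0⟩ : Complexification E) ∈ positiveCone E from ⟨hx, rfl⟩)).1

theorem IsPositiveOperator.realPart_mono (hT : IsPositiveOperator T) {x y : E} (h : x ≤ y) :
    realPart T x ≤ realPart T y := by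
  rw [← sub_nonneg, ← map_sub]
  exact hT.realPart_nonneg (sub_nonneg.2 h)

theorem IsPositiveOperator.im_ofReal (hT : IsPositiveOperator T) (x : E) :
    (T ⟨x, 0⟩).im = 0 := by
  have h : (⟨x, 0⟩ : Complexification E) = ⟨x⁺, 0⟩ - ⟨x⁻, 0⟩ := by
    ext <;> simp [posPart_sub_negPart]
  rw [h, map_sub, sub_im,
    (hT (show (⟨x⁺, 0⟩ : Complexification E) ∈ positiveCone E from ⟨posPart_nonneg x, rfl⟩)).2,
    (hT (show (⟨x⁻, 0⟩ : Complexification E) ∈ positiveCone E from ⟨negPart_nonneg x, rfl⟩)).2,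
    sub_zero]

theorem IsPositiveOperator.apply_eq (hT : IsPositiveOperator T) (z : Complexification E) :
    T z = ⟨realPart T z.re, realPart T z.im⟩ := by
  have h : z = ⟨z.re, 0⟩ + Complex.I • ⟨z.im, 0⟩ := by ext <;> simp
  conv_lhs => rw [h, map_add, map_smul]
  ext <;> simp [realPart_apply, hT.im_ofReal]

theorem IsPositiveOperator.rot_apply (hT : IsPositiveOperator T) (z : Complexification E)
    (θ : ℝ) : rot (T z) θ = realPart T (rot z θ) := by
  rw [hT.apply_eq]
  simp [rot]

theorem IsPositiveOperator.modulus_apply_le (hT : IsPositiveOperator T)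
    (z : Complexification E) : modulus (T z) ≤ realPart T (modulus z) :=
  modulus_le fun θ => by
    rw [hT.rot_apply]
    exact hT.realPart_mono (rot_le_modulus z θ)

theorem IsPositiveOperator.abs_realPart_le (hT : IsPositiveOperator T) (x : E) :
    |realPart T x| ≤ realPart T |x| :=
  abs_le'.2 ⟨hT.realPart_mono (le_abs_self x), by
    rw [← map_neg]; exact hT.realPart_mono (neg_le_abs x)⟩

theorem isPositiveOperator_pow (hT : IsPositiveOperator T) (n : ℕ) :
    IsPositiveOperator (T ^ n) := by
  induction n with
  | zero => exact fun z hz => hz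
  | succ n ih =>
    rw [pow_succ]
    exact ih.comp hT

theorem IsPositiveOperator.realPart_pow (hT : IsPositiveOperator T) (n : ℕ) :
    realPart (T ^ n) = realPart T ^ n := by
  induction n with
  | zero => ext x; simp [realPart_apply]
  | succ n ih =>
    ext x
    rw [pow_succ', pow_succ', ← ih]
    change (T ((T ^ n) ⟨x, 0⟩)).re = (T ⟨((T ^ n) ⟨x, 0⟩).re, 0⟩).re
    rw [hT.apply_eq]
    rfl

theorem IsPositiveOperator.realPart_pow_nonneg (hT : IsPositiveOperator T) (n : ℕ) {x : E}
    (hx : 0 ≤ x) : 0 ≤ (realPart T ^ n) x := by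
  rw [← hT.realPart_pow]
  exact (isPositiveOperator_pow hT n).realPart_nonneg hx

theorem spectralRadius_lt_of_one_lt (hr : spectralRadius ℂ T = 1) {μ : ℂ} (hμ : 1 < ‖μ‖) :
    spectralRadius ℂ T < ‖μ‖₊ := by
  rw [hr, ← ENNReal.coe_one, ENNReal.coe_lt_coe]
  exact hμ

/-- The Neumann series of the resolvent on the real part. -/
theorem IsPositiveOperator.hasSum_realPart_resolvent (hr : spectralRadius ℂ T = 1)
    (hT : IsPositiveOperator T) {s : ℝ} (hs : 1 < s) (x : E) :
    HasSum (fun n : ℕ => (s⁻¹) ^ (n + 1) • (realPart T ^ n) x)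
      (realPart (resolvent T (s : ℂ)) x) := by
  have hs' : 1 < ‖(s : ℂ)‖ := by
    rw [Complex.norm_real]; exact hs.trans_le (le_abs_self s)
  have h := (hasSum_resolvent_apply T (spectralRadius_lt_of_one_lt hr hs') ⟨x, 0⟩).map reL
    continuous_re
  have hfun : (fun n : ℕ => (s⁻¹) ^ (n + 1) • (realPart T ^ n) x) =
      reL ∘ fun n : ℕ => ((s : ℂ)⁻¹) ^ (n + 1) • (T ^ n) ⟨x, 0⟩ := by
    ext n
    rw [← hT.realPart_pow, realPart_apply, Function.comp_apply, ← Complex.ofReal_inv,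
      ← Complex.ofReal_pow, ofReal_smul_eq]
    rfl
  rw [hfun]
  exact h

theorem IsPositiveOperator.realPart_resolvent_nonneg (hT : IsPositiveOperator T)
    (hr : spectralRadius ℂ T = 1) {s : ℝ} (hs : 1 < s) {x : E} (hx : 0 ≤ x) :
    0 ≤ realPart (resolvent T (s : ℂ)) x :=
  (hT.hasSum_realPart_resolvent hr hs x).nonneg fun n =>
    smul_nonneg (by positivity) (hT.realPart_pow_nonneg n hx)

/-- Domination of the resolvent by its values on the positive half-line. -/
theorem IsPositiveOperator.modulus_resolvent_le (hT : IsPositiveOperator T)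
    (hr : spectralRadius ℂ T = 1) {s : ℝ} (hs : 1 < s) {μ : ℂ} (hμ : ‖μ‖ = s)
    (z : Complexification E) :
    modulus (resolvent T μ z) ≤ realPart (resolvent T (s : ℂ)) (modulus z) := by
  have h1 := (hasSum_resolvent_apply T
    (spectralRadius_lt_of_one_lt hr (hs.trans_eq hμ.symm)) z).tendsto_sum_nat
  have h2 := (hT.hasSum_realPart_resolvent hr hs (modulus z)).tendsto_sum_nat
  refine le_of_tendsto_of_tendsto' ((continuous_modulus.tendsto _).comp h1) h2 fun N => ?_
  rw [Function.comp_apply]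
  have hterm : ∀ n : ℕ, modulus (μ⁻¹ ^ (n + 1) • (T ^ n) z) ≤
      s⁻¹ ^ (n + 1) • (realPart T ^ n) (modulus z) := fun n => by
    refine (modulus_smul_le _ _).trans ?_
    rw [norm_pow, norm_inv, hμ, ← hT.realPart_pow]
    exact smul_le_smul_of_nonneg_left ((isPositiveOperator_pow hT n).modulus_apply_le z)
      (by positivity)
  induction N with
  | zero => simpa using modulus_smul_le (0 : ℂ) (0 : Complexification E)
  | succ N ih =>
    rw [Finset.sum_range_succ, Finset.sum_range_succ]
    exact (modulus_add_le _ _).trans (add_le_add ih (hterm N))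

/-- Transfers the growth bound from the real axis to the ray through a peripheral spectral value. -/
theorem IsPositiveOperator.norm_resolvent_le (hT : IsPositiveOperator T)
    (hr : spectralRadius ℂ T = 1) {s : ℝ} (hs : 1 < s) {μ : ℂ} (hμ : ‖μ‖ = s) :
    ‖resolvent T μ‖ ≤ ‖resolvent T (s : ℂ)‖ := by
  refine ContinuousLinearMap.opNorm_le_bound _ (norm_nonneg _) fun z => ?_
  rw [← norm_modulus]
  refine (norm_le_norm_of_nonneg_of_le (modulus_nonneg _)
    (hT.modulus_resolvent_le hr hs hμ z)).trans ?_
  refine ((realPart _).le_opNorm _).trans ?_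
  rw [norm_modulus]
  exact mul_le_mul_of_nonneg_right (norm_realPart_le _) (norm_nonneg _)

end Positive

end Complexification

/-! ### Trigonometric estimates -/

theorem abs_sin_nat_mul_le (n : ℕ) (x : ℝ) : |Real.sin (n * x)| ≤ n * |Real.sin x| := by
  induction n with
  | zero => simp
  | succ n ih =>
    push_cast
    rw [add_mul, one_mul, Real.sin_add]
    refine (abs_add_le _ _).trans ?_
    rw [abs_mul, abs_mul, add_mul, one_mul]
    refine add_le_add ((mul_le_of_le_one_right (abs_nonneg _) (Real.abs_cos_le_one _)).trans ih)
      (mul_le_of_le_one_left (abs_nonneg _) (Real.abs_cos_le_one _))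

theorem abs_sin_int_mul_le (k : ℤ) (x : ℝ) : |Real.sin (k * x)| ≤ |(k : ℝ)| * |Real.sin x| := by
  obtain ⟨n, rfl | rfl⟩ := k.eq_nat_or_neg
  · simpa using abs_sin_nat_mul_le n x
  · simpa using abs_sin_nat_mul_le n x

/-- If `δ / 2` is close to a multiple of `π`, then `k δ` is close to a multiple of `2 π`. -/
theorem half_le_cos_int_mul (k : ℤ) {δ : ℝ}
    (h : Real.cos (1 / (2 * (|(k : ℝ)| + 1))) < |Real.cos (δ / 2)|) :
    1 / 2 ≤ Real.cos (k * δ) := by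
  set a : ℝ := 1 / (2 * (|(k : ℝ)| + 1)) with ha
  have hk : 0 ≤ |(k : ℝ)| := abs_nonneg _
  have ha0 : 0 < a := by positivity
  have hka : |(k : ℝ)| * a ≤ 1 / 2 := by
    rw [ha, mul_one_div, div_le_div_iff₀ (by positivity) (by norm_num)]
    linarith
  have ha1 : a ≤ 1 / 2 := by
    rw [ha, div_le_div_iff₀ (by positivity) (by norm_num)]
    linarith
  have hcosa : 0 ≤ Real.cos a := Real.cos_nonneg_of_mem_Icc
    ⟨by linarith [Real.pi_gt_three], by linarith [Real.pi_gt_three]⟩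
  have hsin : |Real.sin (δ / 2)| ≤ a := by
    have h1 : Real.cos a ^ 2 ≤ Real.cos (δ / 2) ^ 2 := by
      rw [← sq_abs (Real.cos (δ / 2))]
      exact pow_le_pow_left₀ hcosa h.le 2
    have h2 : Real.sin (δ / 2) ^ 2 ≤ Real.sin a ^ 2 := by
      nlinarith [Real.sin_sq_add_cos_sq a, Real.sin_sq_add_cos_sq (δ / 2)]
    exact (sq_le_sq.1 h2).trans ((Real.abs_sin_le_abs).trans_eq (abs_of_pos ha0))
  have h3 : |Real.sin (k * (δ / 2))| ≤ 1 / 2 :=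
    (abs_sin_int_mul_le k _).trans ((mul_le_mul_of_nonneg_left hsin hk).trans hka)
  have h4 : Real.cos (k * δ) = 1 - 2 * Real.sin (k * (δ / 2)) ^ 2 := by
    rw [show (k : ℝ) * δ = 2 * (k * (δ / 2)) by ring, Real.cos_two_mul]
    linarith [Real.sin_sq_add_cos_sq (k * (δ / 2))]
  have h5 : Real.sin (k * (δ / 2)) ^ 2 ≤ (1 / 2) ^ 2 := by
    rw [← sq_abs]
    exact pow_le_pow_left₀ (abs_nonneg _) h3 2
  rw [h4]
  linarith

/-- Gives strict positivity of the constant `sin a - a cos a` in the lower bounds for integrals of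
bumps. -/
theorem mul_cos_lt_sin {a : ℝ} (h0 : 0 < a) (h1 : a < Real.pi / 2) :
    a * Real.cos a < Real.sin a := by
  have h := Real.lt_tan h0 h1
  rwa [Real.tan_eq_sin_div_cos, lt_div_iff₀ (Real.cos_pos_of_mem_Ioo ⟨by linarith, h1⟩)] at h

/-! ### Integrals and disjointness in a Banach lattice -/

section BanachLattice

variable {E : Type*} [NormedAddCommGroup E] [Lattice E] [HasSolidNorm E] [IsOrderedAddMonoid E]
  [NormedSpace ℝ E] [IsOrderedModule ℝ E] [CompleteSpace E]

theorem inf_add_le_inf_add_inf {x a b : E} (hx : 0 ≤ x) (ha : 0 ≤ a) (hb : 0 ≤ b) :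
    x ⊓ (a + b) ≤ x ⊓ a + x ⊓ b := by
  rw [← sub_le_iff_le_add]
  refine le_inf ((sub_le_self _ (le_inf hx hb)).trans inf_le_left) (sub_le_comm.1 (le_inf ?_ ?_))
  · exact (sub_le_self _ ha).trans inf_le_left
  · exact sub_le_iff_le_add'.2 inf_le_right

theorem intervalIntegral_mono_of_continuous {f g : ℝ → E} (hf : Continuous f) (hg : Continuous g)
    {a b : ℝ} (hab : a ≤ b) (h : ∀ θ, f θ ≤ g θ) : ∫ θ in a..b, f θ ≤ ∫ θ in a..b, g θ := by
  rw [intervalIntegral.integral_of_le hab, intervalIntegral.integral_of_le hab]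
  exact MeasureTheory.integral_mono (hf.intervalIntegrable a b).1 (hg.intervalIntegrable a b).1 h

theorem intervalIntegral_nonneg_of_continuous {f : ℝ → E} (hf : Continuous f)
    {a b : ℝ} (hab : a ≤ b) (h : ∀ θ, 0 ≤ f θ) : 0 ≤ ∫ θ in a..b, f θ := by
  simpa using intervalIntegral_mono_of_continuous continuous_const hf hab h

/-- Since `N` is closed, `E ⧸ N` is a normed space; the quotient map commutes with the integral and
kills the integrand. -/
theorem Submodule.intervalIntegral_mem_of_isClosed {N : Submodule ℝ E}
    (hN : IsClosed (N : Set E)) {f : ℝ → E} (hf : Continuous f) (a b : ℝ) (h : ∀ θ, f θ ∈ N) :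
    ∫ θ in a..b, f θ ∈ N := by
  have : IsClosed (N : Set E) := hN
  rw [← Submodule.Quotient.mk_eq_zero, ← Submodule.mkQ_apply]
  have h1 := N.mkQL.intervalIntegral_comp_comm (hf.intervalIntegrable (μ := MeasureTheory.volume) a b)
  have h2 : ∀ θ, N.mkQL (f θ) = 0 := fun θ => (Submodule.Quotient.mk_eq_zero N).2 (h θ)
  simp only [h2, intervalIntegral.integral_zero] at h1
  exact h1.symm

/-- The elements disjoint from a given positive element. -/
def disjointComplement (x : E) (hx : 0 ≤ x) : Submodule ℝ E where
  carrier := {b | x ⊓ |b| = 0}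
  zero_mem' := by simpa using hx
  add_mem' := by
    intro a b ha hb
    refine le_antisymm ?_ (le_inf hx (abs_nonneg _))
    refine (inf_le_inf_left x (abs_add_le a b)).trans ?_
    refine (inf_add_le_inf_add_inf hx (abs_nonneg a) (abs_nonneg b)).trans ?_
    rw [Set.mem_ofPred_eq] at ha hb
    rw [ha, hb, add_zero]
  smul_mem' := by
    intro c b hb
    rw [Set.mem_ofPred_eq] at hb ⊢
    refine le_antisymm ?_ (le_inf hx (abs_nonneg _))
    -- A factor that is at least `|c|` and at least `1`: dividing by it brings `x ⊓ |c • b|` below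
    -- both `|b|` and `x`.
    have ht : (0 : ℝ) < max |c| 1 := lt_max_of_lt_right one_pos
    have key : (max |c| 1)⁻¹ • (x ⊓ |c • b|) ≤ x ⊓ |b| := by
      refine le_inf ?_ ?_
      · rw [inv_smul_le_iff_of_pos ht]
        refine inf_le_left.trans ?_
        simpa using smul_le_smul_of_nonneg_right (le_max_right |c| 1) hx
      · rw [inv_smul_le_iff_of_pos ht]
        exact inf_le_right.trans ((Complexification.abs_smul_le c b).trans
          (smul_le_smul_of_nonneg_right (le_max_left |c| 1) (abs_nonneg b)))
    rw [hb, inv_smul_le_iff_of_pos ht, smul_zero] at key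
    exact key

theorem isClosed_disjointComplement (x : E) (hx : 0 ≤ x) :
    IsClosed (disjointComplement x hx : Set E) := by
  have h : Continuous fun b : E => x ⊓ |b| :=
    continuous_const.inf (continuous_id.sup continuous_neg)
  exact isClosed_singleton.preimage h

/-! ### Bumps: localising the phase of an element -/

namespace Complexification

/-- The part of `|z|` where the phase of `z` is close to `θ`. -/
noncomputable def bump (z : Complexification E) (c θ : ℝ) : E := (rot z θ - c • modulus z)⁺

variable (z : Complexification E)

theorem bump_nonneg (c θ : ℝ) : 0 ≤ bump z c θ := posPart_nonneg _

theorem le_bump (c θ : ℝ) : rot z θ - c • modulus z ≤ bump z c θ := le_posPart _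

theorem bump_le_modulus {c : ℝ} (hc : 0 ≤ c) (θ : ℝ) : bump z c θ ≤ modulus z :=
  sup_le ((sub_le_self _ (smul_nonneg hc (modulus_nonneg z))).trans (rot_le_modulus z θ))
    (modulus_nonneg z)

theorem continuous_bump (c : ℝ) : Continuous (bump z c) :=
  ((continuous_rot z).sub continuous_const).sup continuous_const

theorem bump_periodic (c : ℝ) : Function.Periodic (bump z c) (2 * Real.pi) := fun θ => by
  simp only [bump, rot_periodic z θ]

/-- The sum of `rot z θ` and `rot z φ` is `2 cos((θ - φ)/2)` times `rot z` at the mean angle, hence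
at most `2c |z|`. So one of them can exceed `c |z|` only where the other stays below it. -/
theorem bump_inf_bump {c θ φ : ℝ} (h : |Real.cos ((θ - φ) / 2)| ≤ c) :
    bump z c θ ⊓ bump z c φ = 0 := by
  have hsum : rot z θ + rot z φ = (2 * Real.cos ((θ - φ) / 2)) • rot z ((θ + φ) / 2) := by
    have h1 : θ = (θ + φ) / 2 + (θ - φ) / 2 := by ring
    have h2 : φ = (θ + φ) / 2 - (θ - φ) / 2 := by ring
    have e1 : rot z θ = rot z ((θ + φ) / 2 + (θ - φ) / 2) := by rw [← h1]
    have e2 : rot z φ = rot z ((θ + φ) / 2 - (θ - φ) / 2) := by rw [← h2]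
    rw [e1, e2]
    simp only [rot, Real.cos_add, Real.cos_sub, Real.sin_add, Real.sin_sub]
    module
  have hle : rot z θ + rot z φ ≤ (2 * c) • modulus z := by
    rw [hsum]
    refine (le_abs_self _).trans ((abs_smul_le _ _).trans ?_)
    rw [abs_mul, abs_two]
    refine (smul_le_smul_of_nonneg_left (abs_rot_le_modulus z _) (by positivity)).trans
      (smul_le_smul_of_nonneg_right ?_ (modulus_nonneg z))
    linarith
  have hneg : rot z θ - c • modulus z ≤ -(rot z φ - c • modulus z) := by
    rw [← sub_nonpos]
    have : rot z θ - c • modulus z - -(rot z φ - c • modulus z) =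
        (rot z θ + rot z φ) - (2 * c) • modulus z := by module
    rw [this]
    exact sub_nonpos.2 hle
  refine le_antisymm ?_ (le_inf (bump_nonneg z c θ) (bump_nonneg z c φ))
  have h3 : bump z c θ ≤ (rot z φ - c • modulus z)⁻ := sup_le_sup_right hneg 0
  refine (inf_le_inf_right _ h3).trans ?_
  rw [inf_comm]
  exact (posPart_inf_negPart_eq_zero _).le

theorem integral_rot (α a : ℝ) :
    ∫ θ in (α - a)..(α + a), rot z θ = (2 * Real.sin a) • rot z α := by
  have h1 : Continuous fun θ => Real.cos θ • z.re := Real.continuous_cos.smul continuous_const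
  have h2 : Continuous fun θ => Real.sin θ • z.im := Real.continuous_sin.smul continuous_const
  simp only [rot]
  rw [intervalIntegral.integral_add (h1.intervalIntegrable _ _) (h2.intervalIntegrable _ _),
    intervalIntegral.integral_smul_const, intervalIntegral.integral_smul_const,
    integral_cos, integral_sin, Real.sin_add, Real.sin_sub, Real.cos_add, Real.cos_sub]
  module

/-- The bumps together recover `|z|`. Integrating `rot z θ - cos a • |z|` over the arc of half-width
`a` around `α` gives `2 sin a • rot z α - 2a cos a • |z|`, which is below the full integral of the
bumps; the supremum over `α` turns `rot z α` into `|z|`. -/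
theorem smul_modulus_le_integral_bump {a : ℝ} (h0 : 0 < a) (h1 : a < Real.pi) :
    (2 * (Real.sin a - a * Real.cos a)) • modulus z ≤
      ∫ θ in (0 : ℝ)..(2 * Real.pi), bump z (Real.cos a) θ := by
  set W := ∫ θ in (0 : ℝ)..(2 * Real.pi), bump z (Real.cos a) θ with hW
  have hcont := continuous_bump z (Real.cos a)
  have hsin : 0 < 2 * Real.sin a := mul_pos two_pos (Real.sin_pos_of_pos_of_lt_pi h0 h1)
  have key : ∀ α, (2 * Real.sin a) • rot z α ≤ W + (2 * a * Real.cos a) • modulus z := by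
    intro α
    -- By periodicity the window can be centred at `α`, and then the arc around `α` lies inside it.
    have e1 : W = ∫ θ in (α - Real.pi)..(α + Real.pi), bump z (Real.cos a) θ := by
      have h := (bump_periodic z (Real.cos a)).intervalIntegral_add_eq 0 (α - Real.pi)
      rw [zero_add] at h
      rw [hW, h]
      congr 1
      ring
    have e2 : ∫ θ in (α - Real.pi)..(α + Real.pi), bump z (Real.cos a) θ =
        (∫ θ in (α - Real.pi)..(α - a), bump z (Real.cos a) θ) +
        (∫ θ in (α - a)..(α + a), bump z (Real.cos a) θ) +
        ∫ θ in (α + a)..(α + Real.pi), bump z (Real.cos a) θ := by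
      rw [intervalIntegral.integral_add_adjacent_intervals (hcont.intervalIntegrable _ _)
        (hcont.intervalIntegrable _ _), intervalIntegral.integral_add_adjacent_intervals
        (hcont.intervalIntegrable _ _) (hcont.intervalIntegrable _ _)]
    have n1 : 0 ≤ ∫ θ in (α - Real.pi)..(α - a), bump z (Real.cos a) θ :=
      intervalIntegral_nonneg_of_continuous hcont (by linarith) (bump_nonneg z _)
    have n2 : 0 ≤ ∫ θ in (α + a)..(α + Real.pi), bump z (Real.cos a) θ :=
      intervalIntegral_nonneg_of_continuous hcont (by linarith) (bump_nonneg z _)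
    have n3 : ∫ θ in (α - a)..(α + a), (rot z θ - Real.cos a • modulus z) ≤
        ∫ θ in (α - a)..(α + a), bump z (Real.cos a) θ :=
      intervalIntegral_mono_of_continuous ((continuous_rot z).sub continuous_const) hcont
        (by linarith) (le_bump z _)
    rw [intervalIntegral.integral_sub ((continuous_rot z).intervalIntegrable _ _)
      (continuous_const.intervalIntegrable _ _), integral_rot, intervalIntegral.integral_const,
      smul_smul, show (α + a - (α - a)) * Real.cos a = 2 * a * Real.cos a by ring,
      sub_le_iff_le_add] at n3
    refine n3.trans (add_le_add_left ?_ _)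
    rw [e1, e2]
    exact (le_add_of_nonneg_left n1).trans (le_add_of_nonneg_right n2)
  have h2 : modulus z ≤ (2 * Real.sin a)⁻¹ • (W + (2 * a * Real.cos a) • modulus z) :=
    modulus_le fun α => by
      rw [le_inv_smul_iff_of_pos hsin]
      exact key α
  rw [le_inv_smul_iff_of_pos hsin] at h2
  have h3 : (2 * (Real.sin a - a * Real.cos a)) • modulus z =
      (2 * Real.sin a) • modulus z - (2 * a * Real.cos a) • modulus z := by module
  rw [h3]
  exact sub_le_iff_le_add.2 h2

end Complexification

end BanachLattice

/-! ### Fourier coefficients of the bumps -/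

namespace Complexification

variable {E : Type*} [NormedAddCommGroup E] [Lattice E] [HasSolidNorm E] [IsOrderedAddMonoid E]
  [NormedSpace ℝ E] [IsOrderedModule ℝ E] [CompleteSpace E]

/-- The Fourier coefficient `∫ e^{ikθ} w_θ dθ` of the bumps of `z`; it plays the role of
`|z| (sgn z)^k`. -/
noncomputable def bumpFourier (z : Complexification E) (c : ℝ) (k : ℤ) : Complexification E :=
  ⟨∫ θ in (0 : ℝ)..(2 * Real.pi), Real.cos (k * θ) • bump z c θ,
    ∫ θ in (0 : ℝ)..(2 * Real.pi), Real.sin (k * θ) • bump z c θ⟩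

theorem rot_bumpFourier (z : Complexification E) (c : ℝ) (k : ℤ) (φ : ℝ) :
    rot (bumpFourier z c k) φ =
      ∫ θ in (0 : ℝ)..(2 * Real.pi), Real.cos (k * θ - φ) • bump z c θ := by
  have hb := continuous_bump z c
  have h1 : Continuous fun θ => Real.cos φ • Real.cos (k * θ) • bump z c θ := by fun_prop
  have h2 : Continuous fun θ => Real.sin φ • Real.sin (k * θ) • bump z c θ := by fun_prop
  rw [rot, bumpFourier, ← intervalIntegral.integral_smul, ← intervalIntegral.integral_smul,
    ← intervalIntegral.integral_add (h1.intervalIntegrable _ _) (h2.intervalIntegrable _ _)]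
  refine intervalIntegral.integral_congr fun θ _ => ?_
  simp only [Real.cos_sub]
  module

/-- A lower bound for `∫ e^{ikθ} w_θ dθ`. -/
theorem smul_bump_le_abs_rot_bumpFourier (z : Complexification E) (k : ℤ) {a : ℝ}
    (ha : a = 1 / (2 * (|(k : ℝ)| + 1))) (θ₀ : ℝ) :
    (Real.sin a - a * Real.cos a) • bump z (Real.cos a) θ₀ ≤
      |rot (bumpFourier z (Real.cos a) k) (k * θ₀)| := by
  have hk : 0 ≤ |(k : ℝ)| := abs_nonneg _
  have ha0 : 0 < a := by rw [ha]; positivity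
  have ha1 : a ≤ 1 / 2 := by
    rw [ha, div_le_div_iff₀ (by positivity) (by norm_num)]
    linarith
  have hpi := Real.pi_gt_three
  have hc0 : 0 ≤ Real.cos a := Real.cos_nonneg_of_mem_Icc ⟨by linarith, by linarith⟩
  set c := Real.cos a with hc
  set w := bump z c with hw
  have hwc : Continuous w := continuous_bump z c
  have hw0 : ∀ θ, 0 ≤ w θ := bump_nonneg z c
  set κ := Real.sin a - a * c with hκ
  have hκ0 : 0 ≤ κ := sub_nonneg.2 (mul_cos_lt_sin ha0 (by linarith)).le
  have hκ1 : κ ≤ 1 := by nlinarith [Real.sin_le_one a]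
  set ν := rot (bumpFourier z c k) (k * θ₀) with hν
  -- The deficit of `cos(k(θ - θ₀))` below `1/2`. It vanishes when `w θ` may overlap `w θ₀`, because
  -- then `θ - θ₀` is so close to a multiple of `2π` that the cosine is at least `1/2`. The integral
  -- `B` therefore collects only bumps disjoint from `w θ₀`.
  let m : ℝ → ℝ := fun θ => max (1 / 2 - Real.cos (k * θ - k * θ₀)) 0
  have hmc : Continuous m := by fun_prop
  have hm0 : ∀ θ, 0 ≤ m θ := fun θ => le_max_right _ _
  set B := ∫ θ in (0 : ℝ)..(2 * Real.pi), m θ • w θ with hB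
  have hB0 : 0 ≤ B := intervalIntegral_nonneg_of_continuous (hmc.smul hwc) (by positivity)
    fun θ => smul_nonneg (hm0 θ) (hw0 θ)
  have hdisj : w θ₀ ⊓ B = 0 := by
    have hmem : B ∈ disjointComplement (w θ₀) (hw0 θ₀) := by
      refine Submodule.intervalIntegral_mem_of_isClosed (isClosed_disjointComplement _ _)
        (hmc.smul hwc) _ _ fun θ => ?_
      by_cases h : |Real.cos ((θ - θ₀) / 2)| ≤ c
      · refine Submodule.smul_mem _ _ ?_
        change w θ₀ ⊓ |w θ| = 0
        rw [abs_of_nonneg (hw0 θ), inf_comm]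
        exact bump_inf_bump z h
      · have h1 : 1 / 2 ≤ Real.cos (k * θ - k * θ₀) := by
          rw [← mul_sub]
          exact half_le_cos_int_mul k (by rw [← ha]; exact not_le.1 h)
        have h2 : m θ = 0 := max_eq_right (by linarith)
        change m θ • w θ ∈ _
        rw [h2, zero_smul]
        exact Submodule.zero_mem _
    change w θ₀ ⊓ |B| = 0 at hmem
    rwa [abs_of_nonneg hB0] at hmem
  have hhalf : κ • modulus z ≤ ν + B := by
    have h1 : κ • modulus z ≤ ∫ θ in (0 : ℝ)..(2 * Real.pi), (1 / 2 : ℝ) • w θ := by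
      rw [intervalIntegral.integral_smul]
      have h := smul_le_smul_of_nonneg_left
        (smul_modulus_le_integral_bump z ha0 (by linarith : a < Real.pi))
        (by norm_num : (0 : ℝ) ≤ 1 / 2)
      rwa [smul_smul, ← mul_assoc, show (1 / 2 : ℝ) * 2 = 1 by norm_num, one_mul] at h
    have hcc : Continuous fun θ => Real.cos (k * θ - k * θ₀) • w θ := by fun_prop
    have hmm : Continuous fun θ => m θ • w θ := hmc.smul hwc
    refine h1.trans ?_
    rw [hν, rot_bumpFourier, hB, ← intervalIntegral.integral_add
      (hcc.intervalIntegrable _ _) (hmm.intervalIntegrable _ _)]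
    refine intervalIntegral_mono_of_continuous (by fun_prop) (hcc.add hmm) (by positivity)
      fun θ => ?_
    change _ ≤ Real.cos (k * θ - k * θ₀) • w θ + m θ • w θ
    rw [← add_smul]
    refine smul_le_smul_of_nonneg_right ?_ (hw0 θ)
    linarith [le_max_left (1 / 2 - Real.cos (k * θ - k * θ₀)) 0]
  have hx0 : 0 ≤ κ • w θ₀ := smul_nonneg hκ0 (hw0 θ₀)
  have hle : κ • w θ₀ ≤ |ν| + B :=
    (smul_le_smul_of_nonneg_left (bump_le_modulus z hc0 θ₀) hκ0).trans
      (hhalf.trans (add_le_add_left (le_abs_self ν) B))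
  -- Taking the infimum with `κ • w θ₀` removes the disjoint term `B` from the bound `|ν| + B`.
  calc κ • w θ₀ = κ • w θ₀ ⊓ (|ν| + B) := (inf_eq_left.2 hle).symm
    _ ≤ κ • w θ₀ ⊓ |ν| + κ • w θ₀ ⊓ B := inf_add_le_inf_add_inf hx0 (abs_nonneg ν) hB0
    _ ≤ |ν| + w θ₀ ⊓ B := by
      refine add_le_add inf_le_right (inf_le_inf_right B ?_)
      simpa using smul_le_smul_of_nonneg_right hκ1 (hw0 θ₀)
    _ = |ν| := by rw [hdisj, add_zero]

/-- A closed order ideal. -/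
structure IsClosedIdeal (N : Submodule ℝ E) : Prop where
  isClosed : IsClosed (N : Set E)
  solid : ∀ {x y : E}, |x| ≤ |y| → y ∈ N → x ∈ N

namespace IsClosedIdeal

variable {N : Submodule ℝ E} (hN : IsClosedIdeal N)
include hN

theorem abs_mem {x : E} (hx : x ∈ N) : |x| ∈ N := hN.solid (abs_abs x).le hx

theorem mem_of_abs_le {x y : E} (h : |x| ≤ y) (hy : y ∈ N) : x ∈ N :=
  hN.solid (h.trans (le_abs_self y)) hy

theorem modulus_mem {z : Complexification E} (h1 : z.re ∈ N) (h2 : z.im ∈ N) : modulus z ∈ N :=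
  hN.mem_of_abs_le (by rw [abs_of_nonneg (modulus_nonneg z)]; exact modulus_le_abs_add_abs z)
    (N.add_mem (hN.abs_mem h1) (hN.abs_mem h2))

end IsClosedIdeal

theorem mem_of_bump_mem {N : Submodule ℝ E} (hN : IsClosedIdeal N) (z : Complexification E)
    {a : ℝ} (ha0 : 0 < a) (ha1 : a < Real.pi / 2) (h : ∀ θ, bump z (Real.cos a) θ ∈ N) :
    modulus z ∈ N := by
  have hκ : 0 < 2 * (Real.sin a - a * Real.cos a) :=
    mul_pos two_pos (sub_pos.2 (mul_cos_lt_sin ha0 ha1))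
  have h1 := smul_modulus_le_integral_bump z ha0 (ha1.trans (by linarith [Real.pi_pos]))
  have h2 := Submodule.intervalIntegral_mem_of_isClosed hN.isClosed
    (continuous_bump z (Real.cos a)) 0 (2 * Real.pi) h
  refine (N.smul_mem_iff hκ.ne').1 (hN.mem_of_abs_le ?_ h2)
  rwa [abs_of_nonneg (smul_nonneg hκ.le (modulus_nonneg z))]

end Complexification

/-! ### The cyclicity criterion modulo a closed invariant ideal -/

theorem resolvent_apply_sub {X : Type*} [NormedAddCommGroup X] [NormedSpace ℂ X]
    (T : X →L[ℂ] X) {μ : ℂ} (hμ : μ ∈ resolventSet ℂ T) (x : X) :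
    resolvent T μ (μ • x - T x) = x := by
  have h : resolvent T μ * (algebraMap ℂ (X →L[ℂ] X) μ - T) = 1 := Ring.inverse_mul_cancel _ hμ
  have h2 := congrArg (fun A : X →L[ℂ] X => A x) h
  simpa [Algebra.algebraMap_eq_smul_one] using h2

theorem sub_apply_resolvent {X : Type*} [NormedAddCommGroup X] [NormedSpace ℂ X]
    (T : X →L[ℂ] X) {μ : ℂ} (hμ : μ ∈ resolventSet ℂ T) (x : X) :
    μ • resolvent T μ x - T (resolvent T μ x) = x := by
  have h : (algebraMap ℂ (X →L[ℂ] X) μ - T) * resolvent T μ = 1 := Ring.mul_inverse_cancel _ hμ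
  have h2 := congrArg (fun A : X →L[ℂ] X => A x) h
  simpa [Algebra.algebraMap_eq_smul_one] using h2

namespace Complexification

variable {E : Type*} [NormedAddCommGroup E] [Lattice E] [HasSolidNorm E] [IsOrderedAddMonoid E]
  [NormedSpace ℝ E] [IsOrderedModule ℝ E] [CompleteSpace E]

/-- The complexification of a real subspace. -/
def complexify (N : Submodule ℝ E) : Submodule ℂ (Complexification E) where
  carrier := {z | z.re ∈ N ∧ z.im ∈ N}
  zero_mem' := ⟨N.zero_mem, N.zero_mem⟩
  add_mem' := fun hz hw => ⟨N.add_mem hz.1 hw.1, N.add_mem hz.2 hw.2⟩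
  smul_mem' := fun _ _ hz => ⟨N.sub_mem (N.smul_mem _ hz.1) (N.smul_mem _ hz.2),
    N.add_mem (N.smul_mem _ hz.2) (N.smul_mem _ hz.1)⟩

theorem isClosed_complexify {N : Submodule ℝ E} (hN : IsClosed (N : Set E)) :
    IsClosed (complexify N : Set (Complexification E)) :=
  (hN.preimage continuous_re).inter (hN.preimage continuous_im)

theorem rot_mem_of_mem_complexify {N : Submodule ℝ E} {z : Complexification E}
    (hz : z ∈ complexify N) (θ : ℝ) : rot z θ ∈ N :=
  N.add_mem (N.smul_mem _ hz.1) (N.smul_mem _ hz.2)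

theorem mem_complexify_of_rot_mem {N : Submodule ℝ E} {z : Complexification E}
    (hz : ∀ θ, rot z θ ∈ N) : z ∈ complexify N :=
  ⟨by simpa [rot] using hz 0, by simpa [rot] using hz (Real.pi / 2)⟩

section

variable {T : Complexification E →L[ℂ] Complexification E} {N : Submodule ℝ E}

/-- The partial sums of the Neumann series stay in the closed subspace. This reaches only `‖μ‖ > 1`;
unimodular points have to be approached radially. -/
theorem IsPositiveOperator.resolvent_mem_complexify (hT : IsPositiveOperator T)
    (hr : spectralRadius ℂ T = 1) (hN : IsClosed (N : Set E))
    (hinv : ∀ x ∈ N, realPart T x ∈ N) {μ : ℂ} (hμ : 1 < ‖μ‖) {z : Complexification E}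
    (hz : z ∈ complexify N) : resolvent T μ z ∈ complexify N := by
  have h := (hasSum_resolvent_apply T (spectralRadius_lt_of_one_lt hr hμ) z).tendsto_sum_nat
  refine (isClosed_complexify hN).mem_of_tendsto h (Eventually.of_forall fun n => ?_)
  have hpow : ∀ i : ℕ, (T ^ i) z ∈ complexify N := fun i => by
    induction i with
    | zero => simpa using hz
    | succ i ih =>
      rw [pow_succ']
      change T ((T ^ i) z) ∈ _
      rw [hT.apply_eq]
      exact ⟨hinv _ ih.1, hinv _ ih.2⟩
  exact Submodule.sum_mem _ fun i _ => Submodule.smul_mem _ _ (hpow i)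

theorem modulus_smul_of_norm_eq_one {c : ℂ} (hc : ‖c‖ = 1) (z : Complexification E) :
    modulus (c • z) = modulus z := by
  refine le_antisymm (by simpa [hc] using modulus_smul_le c z) ?_
  have hc0 : c ≠ 0 := by rintro rfl; simp at hc
  simpa [smul_smul, inv_mul_cancel₀ hc0, hc] using modulus_smul_le c⁻¹ (c • z)

/-- An eigenvalue equation modulo a closed ideal makes `|z|` superinvariant modulo the ideal. -/
theorem IsPositiveOperator.modulus_le_of_eigen (hT : IsPositiveOperator T) {lam : ℂ}
    (hlam : ‖lam‖ = 1) (z : Complexification E) :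
    modulus z ≤ realPart T (modulus z) + modulus (T z - lam • z) := by
  rw [← modulus_smul_of_norm_eq_one hlam z]
  have h : lam • z = T z + -(T z - lam • z) := by abel
  calc modulus (lam • z) ≤ modulus (T z) + modulus (-(T z - lam • z)) := by
        conv_lhs => rw [h]
        exact modulus_add_le _ _
    _ ≤ _ := by
        rw [modulus_neg, modulus_smul_of_norm_eq_one hlam]
        exact add_le_add_left (hT.modulus_apply_le z) _

/-- Modulo `N`, applying `T` to `z` rotates its phase by `α`, while `S` commutes with `rot` and
fixes `|z|`; positivity then compares the positive parts. The error `n` does not depend on `θ`, so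
the inequality can be integrated. -/
theorem IsPositiveOperator.exists_bump_le (hT : IsPositiveOperator T) (hN : IsClosedIdeal N)
    {α : ℝ} {z : Complexification E}
    (hz : T z - Complex.exp (α * Complex.I) • z ∈ complexify N)
    (hu : realPart T (modulus z) - modulus z ∈ N) {c : ℝ} (hc0 : 0 ≤ c) :
    ∃ n ∈ N, ∀ θ, bump z c (θ - α) ≤ realPart T (bump z c θ) + n := by
  set g := T z - Complex.exp (α * Complex.I) • z with hg
  set d := realPart T (modulus z) - modulus z with hd
  refine ⟨modulus g + c • |d|, N.add_mem (hN.modulus_mem hz.1 hz.2)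
    (N.smul_mem _ (hN.abs_mem hu)), fun θ => ?_⟩
  have hn0 : 0 ≤ modulus g + c • |d| :=
    add_nonneg (modulus_nonneg g) (smul_nonneg hc0 (abs_nonneg d))
  refine sup_le ?_ (add_nonneg (hT.realPart_nonneg (bump_nonneg z c θ)) hn0)
  have h1 := hT.realPart_mono (le_bump z c θ)
  rw [map_sub, map_smul, ← hT.rot_apply] at h1
  have h2 : rot (T z) θ = rot z (θ - α) + rot g θ := by
    rw [← rot_smul_exp, ← rot_add, hg]
    congr 1
    abel
  have h3 : realPart T (modulus z) = modulus z + d := by rw [hd]; abel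
  rw [h2, h3] at h1
  have h4 : -rot g θ ≤ modulus g := (neg_le_abs _).trans (abs_rot_le_modulus g θ)
  have h5 : c • d ≤ c • |d| := smul_le_smul_of_nonneg_left (le_abs_self d) hc0
  calc rot z (θ - α) - c • modulus z
      = (rot z (θ - α) + rot g θ - c • (modulus z + d)) + (-rot g θ + c • d) := by module
    _ ≤ _ := add_le_add h1 (add_le_add h4 h5)

/-- Substitution and periodicity. That `k` is an integer makes the weight `2π`-periodic. -/
theorem integral_cos_smul_shift (z : Complexification E) (c α φ : ℝ) (k : ℤ) :
    ∫ θ in (0 : ℝ)..(2 * Real.pi), Real.cos (k * θ - φ) • bump z c (θ - α) =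
      rot (bumpFourier z c k) (φ - k * α) := by
  rw [rot_bumpFourier]
  let g : ℝ → E := fun θ => Real.cos (k * θ - (φ - k * α)) • bump z c θ
  have hper : Function.Periodic g (2 * Real.pi) := fun θ => by
    simp only [g, bump_periodic z c θ]
    rw [show (k : ℝ) * (θ + 2 * Real.pi) - (φ - k * α) =
      (k * θ - (φ - k * α)) + k * (2 * Real.pi) by ring, Real.cos_add_int_mul_two_pi]
  have h1 : ∀ θ, Real.cos (k * θ - φ) • bump z c (θ - α) = g (θ - α) := fun θ => by
    simp only [g]
    congr 2
    ring
  simp only [h1]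
  rw [intervalIntegral.integral_comp_sub_right g α]
  have h2 := hper.intervalIntegral_add_eq (0 - α) 0
  rw [zero_add] at h2
  rw [show 2 * Real.pi - α = 0 - α + 2 * Real.pi by ring, h2]

/-- The differences `S w_θ - w_{θ-α}` are nonnegative up to `n ∈ N`, and by `hinc` their integral `S
W - W` lies in `N`. Hence their integrals against bounded weights lie in `N` too. With the weights
`cos(kθ - φ)`, the shift by `α` becomes multiplication by `e^{ikα}`. -/
theorem IsPositiveOperator.apply_bumpFourier_sub_mem (hT : IsPositiveOperator T)
    (hN : IsClosedIdeal N) {α : ℝ} {z : Complexification E}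
    (hz : T z - Complex.exp (α * Complex.I) • z ∈ complexify N)
    (hinc : ∀ (y : E) (C : ℝ), 0 ≤ y → y ≤ C • modulus z →
      (∃ n ∈ N, y ≤ realPart T y + n) → realPart T y - y ∈ N)
    {c : ℝ} (hc0 : 0 ≤ c) (k : ℤ) :
    T (bumpFourier z c k) - Complex.exp (α * Complex.I) ^ k • bumpFourier z c k ∈
      complexify N := by
  have hu : realPart T (modulus z) - modulus z ∈ N :=
    hinc _ 1 (modulus_nonneg z) (one_smul ℝ (modulus z)).ge ⟨_, hN.modulus_mem hz.1 hz.2,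
      hT.modulus_le_of_eigen (Complex.norm_exp_ofReal_mul_I α) z⟩
  obtain ⟨n, hn, hle⟩ := hT.exists_bump_le hN hz hu hc0
  have hpi : (0 : ℝ) ≤ 2 * Real.pi := Real.two_pi_pos.le
  set w := bump z c with hw
  have hwc : Continuous w := continuous_bump z c
  have hsc : Continuous fun θ => w (θ - α) := hwc.comp (continuous_id.sub continuous_const)
  have hSc : Continuous fun θ => realPart T (w θ) := (realPart T).continuous.comp hwc
  set W := ∫ θ in (0 : ℝ)..(2 * Real.pi), w θ with hW
  have hSW : realPart T W = ∫ θ in (0 : ℝ)..(2 * Real.pi), realPart T (w θ) :=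
    ((realPart T).intervalIntegral_comp_comm (hwc.intervalIntegrable _ _)).symm
  have hWs : W = ∫ θ in (0 : ℝ)..(2 * Real.pi), w (θ - α) := by
    have h := integral_cos_smul_shift z c α 0 0
    rw [rot_bumpFourier] at h
    simpa using h.symm
  have hWle : W ≤ (2 * Real.pi) • modulus z := by
    have h := intervalIntegral_mono_of_continuous hwc (continuous_const (y := modulus z)) hpi
      (bump_le_modulus z hc0)
    simpa using h
  have hWn : W ≤ realPart T W + (2 * Real.pi) • n := by
    have h := intervalIntegral_mono_of_continuous hsc (hSc.add (continuous_const (y := n))) hpi hle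
    rw [← hWs] at h
    refine h.trans_eq ?_
    change ∫ θ in (0 : ℝ)..(2 * Real.pi), (realPart T (w θ) + n) = _
    rw [intervalIntegral.integral_add (hSc.intervalIntegrable _ _)
      (continuous_const.intervalIntegrable _ _), ← hSW]
    simp
  have hmem : realPart T W - W ∈ N :=
    hinc W _ (intervalIntegral_nonneg_of_continuous hwc hpi (bump_nonneg z c)) hWle
      ⟨_, N.smul_mem _ hn, hWn⟩
  refine mem_complexify_of_rot_mem fun φ => ?_
  have hexp : Complex.exp (α * Complex.I) ^ k = Complex.exp (((k * α : ℝ) : ℂ) * Complex.I) := by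
    rw [← Complex.exp_int_mul]
    congr 1
    push_cast
    ring
  have hm : Continuous fun θ : ℝ => Real.cos (k * θ - φ) := by fun_prop
  have hm1 : Continuous fun θ : ℝ => Real.cos (k * θ - φ) • realPart T (w θ) := hm.smul hSc
  have hm2 : Continuous fun θ : ℝ => Real.cos (k * θ - φ) • w (θ - α) := hm.smul hsc
  have hm3 : Continuous fun θ : ℝ => Real.cos (k * θ - φ) • w θ := hm.smul hwc
  have hrot : rot (T (bumpFourier z c k) -
      Complex.exp (α * Complex.I) ^ k • bumpFourier z c k) φ =
      ∫ θ in (0 : ℝ)..(2 * Real.pi),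
        Real.cos (k * θ - φ) • (realPart T (w θ) - w (θ - α)) := by
    have e1 : rot (T (bumpFourier z c k)) φ = ∫ θ in (0 : ℝ)..(2 * Real.pi),
        Real.cos (k * θ - φ) • realPart T (w θ) := by
      rw [hT.rot_apply, rot_bumpFourier, ← (realPart T).intervalIntegral_comp_comm
        (hm3.intervalIntegrable _ _)]
      simp [hw]
    have e2 : rot (Complex.exp (α * Complex.I) ^ k • bumpFourier z c k) φ =
        ∫ θ in (0 : ℝ)..(2 * Real.pi), Real.cos (k * θ - φ) • w (θ - α) := by
      rw [hexp, rot_smul_exp, integral_cos_smul_shift]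
    have e3 : ∀ x y : Complexification E, rot (x - y) φ = rot x φ - rot y φ := fun x y => by
      simp only [rot, sub_re, sub_im]; module
    rw [e3, e1, e2]
    simp only [smul_sub]
    exact (intervalIntegral.integral_sub (hm1.intervalIntegrable _ _)
      (hm2.intervalIntegrable _ _)).symm
  rw [hrot]
  -- From `-|n| ≤ x` follows `|x| ≤ x + 2|n|`, which bounds the weighted integrand by an unweighted
  -- one.
  have hbound : ∀ θ, |Real.cos (k * θ - φ) • (realPart T (w θ) - w (θ - α))| ≤
      realPart T (w θ) - w (θ - α) + (2 : ℝ) • |n| := fun θ => by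
    have h1 : -|n| ≤ realPart T (w θ) - w (θ - α) := by
      rw [neg_le_sub_iff_le_add]
      exact (hle θ).trans (add_le_add_right (le_abs_self n) _)
    have h2 : |realPart T (w θ) - w (θ - α)| ≤
        realPart T (w θ) - w (θ - α) + (2 : ℝ) • |n| := by
      refine abs_le'.2 ⟨le_add_of_nonneg_right (smul_nonneg zero_le_two (abs_nonneg n)), ?_⟩
      rw [two_smul]
      have h3 : 0 ≤ realPart T (w θ) - w (θ - α) + |n| := by
        simpa using add_le_add_left h1 |n|
      rw [← sub_nonneg]
      have h4 := add_nonneg h3 h3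
      refine h4.trans_eq ?_
      abel
    refine (abs_smul_le _ _).trans (le_trans ?_ h2)
    simpa using smul_le_smul_of_nonneg_right (Real.abs_cos_le_one (k * θ - φ))
      (abs_nonneg (realPart T (w θ) - w (θ - α)))
  have hmm : Continuous fun θ =>
      Real.cos (k * θ - φ) • (realPart T (w θ) - w (θ - α)) := hm.smul (hSc.sub hsc)
  have hbc : Continuous fun θ => realPart T (w θ) - w (θ - α) + (2 : ℝ) • |n| :=
    (hSc.sub hsc).add continuous_const
  have hI : ∫ θ in (0 : ℝ)..(2 * Real.pi), (realPart T (w θ) - w (θ - α) + (2 : ℝ) • |n|) =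
      (realPart T W - W) + (2 * Real.pi) • (2 : ℝ) • |n| := by
    have hdc : Continuous fun θ => realPart T (w θ) - w (θ - α) := hSc.sub hsc
    rw [intervalIntegral.integral_add (hdc.intervalIntegrable _ _)
      (continuous_const.intervalIntegrable _ _), intervalIntegral.integral_sub
      (hSc.intervalIntegrable _ _) (hsc.intervalIntegrable _ _), ← hSW, ← hWs]
    simp [smul_comm (2 : ℝ)]
  refine hN.mem_of_abs_le (y := (realPart T W - W) + (2 * Real.pi) • (2 : ℝ) • |n|) ?_
    (N.add_mem hmem (N.smul_mem _ (N.smul_mem _ (hN.abs_mem hn))))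
  rw [← hI]
  refine abs_le'.2 ⟨intervalIntegral_mono_of_continuous hmm hbc hpi
    fun θ => (le_abs_self _).trans (hbound θ), ?_⟩
  rw [← intervalIntegral.integral_neg]
  exact intervalIntegral_mono_of_continuous hmm.neg hbc hpi
    fun θ => (neg_le_abs _).trans (hbound θ)

/-- A cyclicity criterion: `lam` is an eigenvalue modulo a closed invariant ideal modulo which
order bounded increasing orbits are constant. -/
theorem IsPositiveOperator.zpow_mem_spectrum (hT : IsPositiveOperator T)
    (hr : spectralRadius ℂ T = 1) (hN : IsClosedIdeal N)
    (hinv : ∀ x ∈ N, realPart T x ∈ N) {lam : ℂ} (hlam : ‖lam‖ = 1) {z : Complexification E}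
    (hz : T z - lam • z ∈ complexify N) (hzN : modulus z ∉ N)
    (hinc : ∀ (y : E) (C : ℝ), 0 ≤ y → y ≤ C • modulus z →
      (∃ n ∈ N, y ≤ realPart T y + n) → realPart T y - y ∈ N)
    (k : ℤ) : lam ^ k ∈ spectrum ℂ T := by
  by_contra hk
  have hk' : lam ^ k ∈ resolventSet ℂ T := not_not.1 hk
  obtain ⟨α, hα⟩ : ∃ α : ℝ, lam = Complex.exp (α * Complex.I) :=
    ⟨lam.arg, by simpa [hlam] using (Complex.norm_mul_exp_arg_mul_I lam).symm⟩
  set a : ℝ := 1 / (2 * (|(k : ℝ)| + 1)) with ha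
  have hk0 : 0 ≤ |(k : ℝ)| := abs_nonneg _
  have ha0 : 0 < a := by rw [ha]; positivity
  have ha1 : a ≤ 1 / 2 := by
    rw [ha, div_le_div_iff₀ (by positivity) (by norm_num)]
    linarith
  have hpi := Real.pi_gt_three
  have hc0 : 0 ≤ Real.cos a := Real.cos_nonneg_of_mem_Icc ⟨by linarith, by linarith⟩
  set v := bumpFourier z (Real.cos a) k with hv
  have hg : T v - lam ^ k • v ∈ complexify N := by
    rw [hα] at hz ⊢
    exact hT.apply_bumpFourier_sub_mem hN hz hinc hc0 k
  have hnorm : ‖lam ^ k‖ = 1 := by rw [norm_zpow, hlam, one_zpow]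
  -- Applying the resolvent at `μ = t λ^k`, `t > 1`, shows that `v - (μ - λ^k) R(μ) v` equals
  -- `-R(μ)(T v - λ^k v)`, which lies in the complexified ideal. As `t ↓ 1`, `R(μ) v` converges
  -- because `λ^k` is assumed to be in the resolvent set, so the left side tends to `v`.
  have hvN : v ∈ complexify N := by
    have hμ : Tendsto (fun t : ℝ => (t : ℂ) * lam ^ k) (𝓝[>] 1) (𝓝 (lam ^ k)) := by
      have h : Tendsto (fun t : ℝ => (t : ℂ) * lam ^ k) (𝓝 1) (𝓝 (((1 : ℝ) : ℂ) * lam ^ k)) :=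
        (Complex.continuous_ofReal.tendsto 1).mul_const _
      rw [Complex.ofReal_one, one_mul] at h
      exact h.mono_left nhdsWithin_le_nhds
    have hR : Tendsto (fun t : ℝ => resolvent T ((t : ℂ) * lam ^ k)) (𝓝[>] 1)
        (𝓝 (resolvent T (lam ^ k))) :=
      (spectrum.hasDerivAt_resolvent_const_left hk').continuousAt.tendsto.comp hμ
    have hRv : Tendsto (fun t : ℝ => resolvent T ((t : ℂ) * lam ^ k) v) (𝓝[>] 1)
        (𝓝 (resolvent T (lam ^ k) v)) :=
      ((ContinuousLinearMap.apply ℂ _ v).continuous.tendsto _).comp hR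
    have hlim : Tendsto (fun t : ℝ => v - ((t : ℂ) * lam ^ k - lam ^ k) •
        resolvent T ((t : ℂ) * lam ^ k) v) (𝓝[>] 1) (𝓝 v) := by
      have h := tendsto_const_nhds (x := v) |>.sub ((hμ.sub_const (lam ^ k)).smul hRv)
      simpa using h
    refine (isClosed_complexify hN.isClosed).mem_of_tendsto hlim ?_
    filter_upwards [self_mem_nhdsWithin] with t ht
    have ht1 : (1 : ℝ) < t := ht
    have hn : 1 < ‖(t : ℂ) * lam ^ k‖ := by
      rw [norm_mul, hnorm, mul_one, Complex.norm_real]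
      exact ht1.trans_le (le_abs_self t)
    have hρ := spectrum.mem_resolventSet_of_spectralRadius_lt (spectralRadius_lt_of_one_lt hr hn)
    have h1 := hT.resolvent_mem_complexify hr hN.isClosed hinv hn
      ((complexify N).neg_mem hg)
    have h2 := resolvent_apply_sub T hρ v
    have h3 : ((t : ℂ) * lam ^ k) • v - T v =
        ((t : ℂ) * lam ^ k - lam ^ k) • v + -(T v - lam ^ k • v) := by module
    rw [h3, map_add, map_smul] at h2
    rw [SetLike.mem_coe]
    convert h1 using 1
    exact sub_eq_iff_eq_add'.2 h2.symm
  -- Each bump is dominated by a multiple of some `|rot v _|`, so all bumps lie in `N`, and then so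
  -- does `|z|`.
  refine hzN (mem_of_bump_mem hN z ha0 (by linarith) fun θ => ?_)
  have h1 := smul_bump_le_abs_rot_bumpFourier z k ha θ
  have hκ : 0 < Real.sin a - a * Real.cos a := sub_pos.2 (mul_cos_lt_sin ha0 (by linarith))
  refine (N.smul_mem_iff hκ.ne').1 (hN.mem_of_abs_le ?_
    (hN.abs_mem (rot_mem_of_mem_complexify hvN (k * θ))))
  rwa [abs_of_nonneg (smul_nonneg hκ.le (bump_nonneg z _ θ))]

end

end Complexification

/-! ### Gauges and their null ideals -/

namespace Complexification

variable {E : Type*} [NormedAddCommGroup E] [Lattice E] [HasSolidNorm E] [IsOrderedAddMonoid E]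
  [NormedSpace ℝ E] [IsOrderedModule ℝ E] [CompleteSpace E]

/-- A monotone superlinear gauge on the positive cone, subadditive up to a constant, which
increases along the orbits of `S`. -/
structure IsGauge (S : E →L[ℝ] E) (q : E → ℝ) : Prop where
  nonneg : ∀ {x}, 0 ≤ x → 0 ≤ q x
  mono : ∀ {x y}, 0 ≤ x → x ≤ y → q x ≤ q y
  superadd : ∀ {x y}, 0 ≤ x → 0 ≤ y → q x + q y ≤ q (x + y)
  subadd : ∀ {x y}, 0 ≤ x → 0 ≤ y → q (x + y) ≤ 2 * (q x + q y)
  smul : ∀ {c : ℝ} {x}, 0 ≤ c → 0 ≤ x → q (c • x) = c * q x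
  bound : ∃ C, ∀ {x}, 0 ≤ x → q x ≤ C * ‖x‖
  le_apply : ∀ {x}, 0 ≤ x → q x ≤ q (S x)

namespace IsGauge

variable {T : Complexification E →L[ℂ] Complexification E} {q : E → ℝ}
  (hT : IsPositiveOperator T) (hq : IsGauge (realPart T) q)

include hq in
theorem zero : q 0 = 0 := by simpa using hq.smul le_rfl (le_refl (0 : E))

include hT hq in
theorem le_pow_apply {x : E} (hx : 0 ≤ x) {m n : ℕ} (hmn : m ≤ n) :
    q ((realPart T ^ m) x) ≤ q ((realPart T ^ n) x) := by
  induction n, hmn using Nat.le_induction with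
  | base => rfl
  | succ n _ ih =>
    rw [pow_succ']
    exact ih.trans (hq.le_apply (hT.realPart_pow_nonneg n hx))

include hT in
theorem pow_mono (n : ℕ) {x y : E} (h : x ≤ y) : (realPart T ^ n) x ≤ (realPart T ^ n) y := by
  rw [← hT.realPart_pow]
  exact (isPositiveOperator_pow hT n).realPart_mono h

/-- The largest invariant ideal on which the gauge vanishes. -/
def nullIdeal : Submodule ℝ E where
  carrier := {x | ∀ n, q ((realPart T ^ n) |x|) = 0}
  zero_mem' := fun n => by simp [hq.zero]
  add_mem' := by
    intro x y hx hy n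
    have h0 := hT.realPart_pow_nonneg n (abs_nonneg (x + y))
    have hx0 := hT.realPart_pow_nonneg n (abs_nonneg x)
    have hy0 := hT.realPart_pow_nonneg n (abs_nonneg y)
    refine le_antisymm ?_ (hq.nonneg h0)
    have h1 := hq.mono h0 (pow_mono hT n (abs_add_le x y))
    rw [map_add] at h1
    refine h1.trans ((hq.subadd hx0 hy0).trans_eq ?_)
    rw [hx n, hy n]
    norm_num
  smul_mem' := by
    intro c x hx n
    have h0 := hT.realPart_pow_nonneg n (abs_nonneg (c • x))
    refine le_antisymm ?_ (hq.nonneg h0)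
    have h1 := hq.mono h0 (pow_mono hT n (abs_smul_le c x))
    rwa [map_smul, hq.smul (abs_nonneg c) (hT.realPart_pow_nonneg n (abs_nonneg x)), hx n,
      mul_zero] at h1

/-- Closedness needs no continuity of `q`: subadditivity up to a constant and the norm bound give `q
(S^n |x|) ≤ 2C ‖S^n |x - s i|‖` whenever the `s i` lie in the ideal. -/
theorem isClosedIdeal_nullIdeal : IsClosedIdeal (nullIdeal hT hq) where
  solid := by
    intro x y hxy hy n
    have h0 := hT.realPart_pow_nonneg n (abs_nonneg x)
    exact le_antisymm ((hq.mono h0 (pow_mono hT n hxy)).trans_eq (hy n)) (hq.nonneg h0)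
  isClosed := by
    obtain ⟨C, hC⟩ := hq.bound
    refine isClosed_of_closure_subset fun x hx n => ?_
    obtain ⟨s, hs, hlim⟩ := mem_closure_iff_seq_limit.1 hx
    have h0 := hT.realPart_pow_nonneg n (abs_nonneg x)
    refine le_antisymm ?_ (hq.nonneg h0)
    have hle : ∀ i, q ((realPart T ^ n) |x|) ≤ 2 * (C * ‖(realPart T ^ n) |x - s i|‖) := by
      intro i
      have hi0 := hT.realPart_pow_nonneg n (abs_nonneg (x - s i))
      have hs0 := hT.realPart_pow_nonneg n (abs_nonneg (s i))
      have h1 : |x| ≤ |x - s i| + |s i| := by simpa using abs_add_le (x - s i) (s i)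
      have h2 := hq.mono h0 (pow_mono hT n h1)
      rw [map_add] at h2
      have h3 := hq.subadd hi0 hs0
      rw [hs i n, add_zero] at h3
      exact h2.trans (h3.trans (mul_le_mul_of_nonneg_left (hC hi0) zero_le_two))
    have hl : Tendsto (fun i => 2 * (C * ‖(realPart T ^ n) |x - s i|‖)) atTop (𝓝 0) := by
      have habs : Continuous fun y : E => |y| := continuous_id.sup continuous_neg
      have hc : Continuous fun y : E => 2 * (C * ‖(realPart T ^ n) |x - y|‖) :=
        continuous_const.mul (continuous_const.mul ((ContinuousLinearMap.continuous _).comp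
          (habs.comp (continuous_const.sub continuous_id))).norm)
      have h := (hc.tendsto x).comp hlim
      rw [sub_self, abs_zero, map_zero, norm_zero, mul_zero, mul_zero] at h
      exact h
    exact ge_of_tendsto' hl hle

theorem apply_mem_nullIdeal {x : E} (hx : x ∈ nullIdeal hT hq) :
    realPart T x ∈ nullIdeal hT hq := by
  intro n
  have h0 := hT.realPart_pow_nonneg n (abs_nonneg (realPart T x))
  refine le_antisymm ?_ (hq.nonneg h0)
  have h1 := hq.mono h0 (pow_mono hT n (hT.abs_realPart_le x))
  have h2 : (realPart T ^ n) (realPart T |x|) = (realPart T ^ (n + 1)) |x| := by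
    rw [pow_succ]
    rfl
  rw [h2, hx (n + 1)] at h1
  exact h1

theorem pow_apply_mem_nullIdeal {x : E} (hx : x ∈ nullIdeal hT hq) (n : ℕ) :
    (realPart T ^ n) x ∈ nullIdeal hT hq := by
  induction n with
  | zero => exact hx
  | succ n ih =>
    rw [pow_succ']
    exact apply_mem_nullIdeal hT hq ih

include hT hq in
theorem gauge_eq_zero {x : E} (hx0 : 0 ≤ x) (hx : x ∈ nullIdeal hT hq) : q x = 0 := by
  have h := hx 0
  rwa [abs_of_nonneg hx0] at h

include hq in
theorem sum_le {ι : Type*} (s : Finset ι) {f : ι → E} (hf : ∀ i, 0 ≤ f i) :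
    ∑ i ∈ s, q (f i) ≤ q (∑ i ∈ s, f i) := by
  classical
  induction s using Finset.induction_on with
  | empty => simp [hq.zero]
  | insert i s hi ih =>
    rw [Finset.sum_insert hi, Finset.sum_insert hi]
    exact (add_le_add_right ih _).trans (hq.superadd (hf i) (Finset.sum_nonneg fun j _ => hf j))

/-- Order bounded increasing orbits are constant modulo the null ideal. -/
theorem apply_sub_mem_nullIdeal {u : E} (hu : 0 ≤ u) {K : ℝ}
    (hK : ∀ n, q ((realPart T ^ n) u) ≤ K) {y : E} {C : ℝ} (hy0 : 0 ≤ y) (hyC : y ≤ C • u)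
    {n : E} (hn : n ∈ nullIdeal hT hq) (hyn : y ≤ realPart T y + n) :
    realPart T y - y ∈ nullIdeal hT hq := by
  set N := nullIdeal hT hq with hN
  have hNI : IsClosedIdeal N := isClosedIdeal_nullIdeal hT hq
  set S := realPart T with hS
  set e := (S y - y)⁺ with he
  have he0 : 0 ≤ e := posPart_nonneg _
  -- Since `y ≤ S y + n`, the negative part of `S y - y` is at most `|n|`; only the positive part
  -- `e` remains to be treated.
  have hneg : (S y - y)⁻ ∈ N := by
    refine hNI.mem_of_abs_le ?_ (hNI.abs_mem hn)
    rw [abs_of_nonneg (negPart_nonneg _)]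
    refine sup_le ?_ (abs_nonneg n)
    rw [neg_sub, sub_le_iff_le_add']
    exact hyn.trans (add_le_add_right (le_abs_self n) _)
  suffices hmem : e ∈ N by
    rw [← posPart_sub_negPart (S y - y)]
    exact N.sub_mem hmem hneg
  set n' := (S y - y)⁻ with hn'
  have hn'0 : 0 ≤ n' := negPart_nonneg _
  have hdec : e = S y - y + n' := by
    rw [he, hn', ← sub_eq_iff_eq_add.1 (posPart_sub_negPart (S y - y))]
  have hC0 : C • u ≤ |C| • u := smul_le_smul_of_nonneg_right (le_abs_self C) hu
  have hsum : ∀ m : ℕ, ∑ i ∈ Finset.range m, (S ^ i) e =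
      (S ^ m) y - y + ∑ i ∈ Finset.range m, (S ^ i) n' := by
    intro m
    induction m with
    | zero => simp
    | succ m ih =>
      rw [Finset.sum_range_succ, Finset.sum_range_succ, ih, hdec, map_add, map_sub]
      have : (S ^ m) (S y) = (S ^ (m + 1)) y := by rw [pow_succ]; rfl
      rw [this]
      abel
  -- The telescoped sum is at most `S^m y` plus an element of the ideal. Superadditivity bounds the
  -- sum of gauges by the gauge of the sum, and `y ≤ C • u` bounds the latter uniformly in `m`.
  have hbound : ∀ m : ℕ, ∑ i ∈ Finset.range m, q ((S ^ i) e) ≤ 2 * (|C| * K) := by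
    intro m
    have hsn : ∑ i ∈ Finset.range m, (S ^ i) n' ∈ N :=
      N.sum_mem fun i _ => pow_apply_mem_nullIdeal hT hq hneg i
    have hsn0 : 0 ≤ ∑ i ∈ Finset.range m, (S ^ i) n' :=
      Finset.sum_nonneg fun i _ => hT.realPart_pow_nonneg i hn'0
    have hSm0 : 0 ≤ (S ^ m) y := hT.realPart_pow_nonneg m hy0
    have h1 := sum_le hq (Finset.range m) (f := fun i => (S ^ i) e)
      fun i => hT.realPart_pow_nonneg i he0
    have h2 : ∑ i ∈ Finset.range m, (S ^ i) e ≤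
        (S ^ m) y + ∑ i ∈ Finset.range m, (S ^ i) n' := by
      rw [hsum]
      exact add_le_add_left (sub_le_self _ hy0) _
    have h3 := hq.mono (Finset.sum_nonneg fun i _ => hT.realPart_pow_nonneg i he0) h2
    have h4 := hq.subadd hSm0 hsn0
    rw [gauge_eq_zero hT hq hsn0 hsn, add_zero] at h4
    have h5 : q ((S ^ m) y) ≤ |C| * K := by
      have h := hq.mono hSm0 (pow_mono hT m (hyC.trans hC0))
      rw [map_smul, hq.smul (abs_nonneg C) (hT.realPart_pow_nonneg m hu)] at h
      exact h.trans (mul_le_mul_of_nonneg_left (hK m) (abs_nonneg C))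
    linarith
  intro j
  rw [abs_of_nonneg he0]
  have hj0 := hq.nonneg (hT.realPart_pow_nonneg j he0)
  by_contra hne
  have hpos : 0 < q ((S ^ j) e) := lt_of_le_of_ne hj0 (Ne.symm hne)
  -- The terms `q (S^i e)` are nondecreasing in `i`, so one positive term would make the partial
  -- sums unbounded.
  obtain ⟨m, hm⟩ := exists_nat_gt (2 * (|C| * K) / q ((S ^ j) e))
  rw [div_lt_iff₀ hpos] at hm
  have h1 := hbound (j + m)
  rw [Finset.sum_range_add] at h1
  have h2 : (m : ℝ) * q ((S ^ j) e) ≤ ∑ i ∈ Finset.range m, q ((S ^ (j + i)) e) := by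
    have h := Finset.card_nsmul_le_sum (Finset.range m) (fun i => q ((S ^ (j + i)) e))
      (q ((S ^ j) e)) fun i _ => le_pow_apply hT hq he0 (Nat.le_add_right j i)
    simpa using h
  have h3 : 0 ≤ ∑ i ∈ Finset.range j, q ((S ^ i) e) :=
    Finset.sum_nonneg fun i _ => hq.nonneg (hT.realPart_pow_nonneg i he0)
  linarith

include hT hq in
/-- The cyclicity criterion in terms of a gauge. -/
theorem zpow_mem_spectrum (hr : spectralRadius ℂ T = 1) {lam : ℂ} (hlam : ‖lam‖ = 1)
    {z : Complexification E} (hz : T z - lam • z ∈ complexify (nullIdeal hT hq))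
    (hzq : q (modulus z) ≠ 0) {K : ℝ} (hK : ∀ n, q ((realPart T ^ n) (modulus z)) ≤ K) (k : ℤ) :
    lam ^ k ∈ spectrum ℂ T :=
  hT.zpow_mem_spectrum hr (isClosedIdeal_nullIdeal hT hq)
    (fun _ hx => apply_mem_nullIdeal hT hq hx) hlam hz
    (fun h => hzq (gauge_eq_zero hT hq (modulus_nonneg z) h))
    (fun _ _ hy0 hyC ⟨_, hn, hyn⟩ =>
      apply_sub_mem_nullIdeal hT hq (modulus_nonneg z) hK hy0 hyC hn hyn) k

end IsGauge

end Complexification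

/-! ### Positive functionals by separation -/

section Separation

variable {E : Type*} [NormedAddCommGroup E] [Lattice E] [HasSolidNorm E] [IsOrderedAddMonoid E]
  [NormedSpace ℝ E] [IsOrderedModule ℝ E] [CompleteSpace E]

/-- A convex upward closed set at positive distance from `0` is separated from `0` by a positive
functional. -/
theorem exists_positive_functional {s : Set E} (hs : Convex ℝ s) (hne : s.Nonempty)
    (hup : ∀ x ∈ s, ∀ y, 0 ≤ y → x + y ∈ s) {δ : ℝ} (hδ : 0 < δ) (hball : ∀ x ∈ s, δ ≤ ‖x‖) :
    ∃ χ : E →L[ℝ] ℝ, (∀ x, 0 ≤ x → 0 ≤ χ x) ∧ ∃ ε > 0, ∀ x ∈ s, ε ≤ χ x := by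
  have hdisj : Disjoint (Metric.ball (0 : E) δ) s := by
    rw [Set.disjoint_left]
    intro x hx hxs
    exact absurd (hball x hxs) (not_le.2 (by simpa using hx))
  obtain ⟨χ, ε, h1, h2⟩ := geometric_hahn_banach_open (convex_ball (0 : E) δ)
    Metric.isOpen_ball hs hdisj
  have hε : 0 < ε := by simpa using h1 0 (Metric.mem_ball_self hδ)
  refine ⟨χ, fun x hx => ?_, ε, hε, h2⟩
  by_contra hneg
  rw [not_le] at hneg
  obtain ⟨y, hy⟩ := hne
  have hχy : 0 < χ y := hε.trans_le (h2 y hy)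
  -- If `χ x < 0` for some `x ≥ 0`, moving `y` by this multiple of `x` stays in `s` and brings the
  -- value of `χ` down to `0 < ε`.
  have ht : 0 ≤ χ y / -χ x := div_nonneg hχy.le (by linarith)
  have h3 := h2 _ (hup y hy ((χ y / -χ x) • x) (smul_nonneg ht hx))
  rw [map_add, map_smul, smul_eq_mul, div_mul_eq_mul_div, div_neg,
    mul_div_assoc, div_self hneg.ne, mul_one] at h3
  linarith

/-- The set to separate from `0` is `{x | e ≤ x}`, whose elements have norm at least `‖e‖`. -/
theorem exists_positive_functional_pos {e : E} (he : 0 ≤ e) (hne : e ≠ 0) :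
    ∃ χ : E →L[ℝ] ℝ, (∀ x, 0 ≤ x → 0 ≤ χ x) ∧ 0 < χ e := by
  obtain ⟨χ, h1, ε, hε, h2⟩ := exists_positive_functional (convex_Ici (𝕜 := ℝ) e)
    ⟨e, le_refl e⟩ (fun x hx y hy => le_add_of_le_of_nonneg hx hy) (norm_pos_iff.2 hne)
    fun x hx => Complexification.norm_le_norm_of_nonneg_of_le he hx
  exact ⟨χ, h1, hε.trans_le (h2 e (le_refl e))⟩

end Separation

/-! ### Gauges from eigenfunctionals and invariant functionals -/

namespace Complexification

variable {E : Type*} [NormedAddCommGroup E] [Lattice E] [HasSolidNorm E] [IsOrderedAddMonoid E]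
  [NormedSpace ℝ E] [IsOrderedModule ℝ E] [CompleteSpace E]
  {T : Complexification E →L[ℂ] Complexification E}

/-- A nonzero gauge is dominated by a positive functional. -/
theorem IsGauge.exists_functional {S : E →L[ℝ] E} {q : E → ℝ} (hq : IsGauge S q) {x₀ : E}
    (hx₀ : 0 ≤ x₀) (hpos : 0 < q x₀) :
    ∃ χ : E →L[ℝ] ℝ, (∀ x, 0 ≤ x → 0 ≤ χ x) ∧ ∃ ε > 0, ∀ x, 0 ≤ x → ε * q x ≤ χ x := by
  obtain ⟨C, hC⟩ := hq.bound
  have hscale : ∀ x, 0 ≤ x → 0 < q x → 0 ≤ (q x)⁻¹ • x ∧ 1 ≤ q ((q x)⁻¹ • x) :=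
    fun x hx hqx => ⟨smul_nonneg (inv_nonneg.2 hqx.le) hx, by
      rw [hq.smul (inv_nonneg.2 hqx.le) hx, inv_mul_cancel₀ hqx.ne']⟩
  have hC1 : 0 < max C 1 := lt_max_of_lt_right one_pos
  -- The set to separate from `0` is `{x ≥ 0 | q x ≥ 1}`: superadditivity makes it convex, and the
  -- norm bound keeps it away from `0`.
  have hconv : Convex ℝ {x : E | 0 ≤ x ∧ 1 ≤ q x} := by
    intro x hx y hy a b ha hb hab
    refine ⟨add_nonneg (smul_nonneg ha hx.1) (smul_nonneg hb hy.1), ?_⟩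
    refine le_trans ?_ (hq.superadd (smul_nonneg ha hx.1) (smul_nonneg hb hy.1))
    rw [hq.smul ha hx.1, hq.smul hb hy.1]
    nlinarith [hx.2, hy.2]
  obtain ⟨χ, h1, ε, hε, h2⟩ := exists_positive_functional hconv
    ⟨_, hscale x₀ hx₀ hpos⟩
    (fun x hx y hy => ⟨add_nonneg hx.1 hy, hx.2.trans (hq.mono hx.1 (le_add_of_nonneg_right hy))⟩)
    (inv_pos.2 hC1) (fun x hx => by
      rw [inv_le_iff_one_le_mul₀' hC1]
      exact hx.2.trans ((hC hx.1).trans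
        (mul_le_mul_of_nonneg_right (le_max_left C 1) (norm_nonneg x))))
  refine ⟨χ, h1, ε, hε, fun x hx => ?_⟩
  rcases (hq.nonneg hx).eq_or_lt with h0 | h0
  · rw [← h0, mul_zero]
    exact h1 x hx
  · have h3 := h2 _ (hscale x hx h0)
    rwa [map_smul, smul_eq_mul, inv_mul_eq_div, le_div_iff₀ h0] at h3

/-- An invariant positive functional is a gauge. -/
theorem isGauge_of_functional {S : E →L[ℝ] E} {ψ : E →L[ℝ] ℝ} (h0 : ∀ x, 0 ≤ x → 0 ≤ ψ x)
    (hS : ∀ x, ψ (S x) = ψ x) : IsGauge S ψ where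
  nonneg := h0 _
  mono := fun {x y} _ h => by
    have := h0 _ (sub_nonneg.2 h)
    rw [map_sub] at this
    linarith
  superadd := fun _ _ => (map_add ψ _ _).ge
  subadd := fun {x y} hx hy => by
    rw [map_add]
    linarith [h0 x hx, h0 y hy]
  smul := fun _ _ => by simp
  bound := ⟨‖ψ‖, fun _ => (le_abs_self _).trans (ψ.le_opNorm _)⟩
  le_apply := fun {x} _ => (hS x).ge

/-- The gauge of an eigenfunctional: the modulus of the functional. -/
noncomputable def functionalGauge (φ : Complexification E →L[ℂ] ℂ) (x : E) : ℝ :=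
  sSup {t | ∃ w, modulus w ≤ x ∧ ‖φ w‖ = t}

section functionalGauge

variable (φ : Complexification E →L[ℂ] ℂ)

theorem norm_le_of_modulus_le {w : Complexification E} {x : E} (h : modulus w ≤ x) :
    ‖φ w‖ ≤ ‖φ‖ * ‖x‖ :=
  (φ.le_opNorm w).trans (mul_le_mul_of_nonneg_left
    (norm_le_norm_of_nonneg_of_le (modulus_nonneg w) h) (norm_nonneg φ))

theorem le_functionalGauge {w : Complexification E} {x : E} (h : modulus w ≤ x) :
    ‖φ w‖ ≤ functionalGauge φ x :=
  le_csSup ⟨‖φ‖ * ‖x‖, by rintro _ ⟨w, hw, rfl⟩; exact norm_le_of_modulus_le φ hw⟩ ⟨w, h, rfl⟩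

theorem functionalGauge_le {x : E} (hx : 0 ≤ x) {b : ℝ}
    (h : ∀ w, modulus w ≤ x → ‖φ w‖ ≤ b) : functionalGauge φ x ≤ b := by
  refine csSup_le ⟨_, 0, ?_, rfl⟩ (by rintro _ ⟨w, hw, rfl⟩; exact h w hw)
  have : modulus (0 : Complexification E) ≤ 0 := by
    simpa using modulus_smul_le (0 : ℂ) (0 : Complexification E)
  exact this.trans hx

/-- Riesz decomposition of an element of the real part. -/
theorem exists_abs_decomposition {a x y : E} (hx : 0 ≤ x) (hy : 0 ≤ y) (h : |a| ≤ x + y) :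
    ∃ b c, a = b + c ∧ |b| ≤ x ∧ |c| ≤ y := by
  have h1 : a ≤ x + y := (le_abs_self a).trans h
  have h2 : -a ≤ x + y := (neg_le_abs a).trans h
  -- The first summand is the truncation of `a` to the order interval `[-x, x]`.
  refine ⟨(a ⊓ x) ⊔ -x, a - (a ⊓ x) ⊔ -x, by abel, ?_, ?_⟩
  · exact abs_le'.2 ⟨sup_le inf_le_right ((neg_nonpos.2 hx).trans hx),
      neg_le.1 le_sup_right⟩
  · refine abs_le'.2 ⟨?_, ?_⟩
    · rw [sub_le_comm]
      refine le_sup_of_le_left (le_inf (sub_le_self a hy) ?_)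
      rwa [sub_le_iff_le_add]
    · rw [neg_sub, sub_le_iff_le_add']
      refine sup_le (inf_le_left.trans (le_add_of_nonneg_right hy)) ?_
      rw [neg_le_iff_add_nonneg]
      rw [neg_le_iff_add_nonneg] at h2
      refine h2.trans_eq ?_
      abel

theorem norm_apply_ofReal_le {a x y : E} (hx : 0 ≤ x) (hy : 0 ≤ y) (h : |a| ≤ x + y) :
    ‖φ ⟨a, 0⟩‖ ≤ functionalGauge φ x + functionalGauge φ y := by
  obtain ⟨b, c, rfl, hb, hc⟩ := exists_abs_decomposition hx hy h
  have : (⟨b + c, 0⟩ : Complexification E) = ⟨b, 0⟩ + ⟨c, 0⟩ := by ext <;> simp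
  rw [this, map_add]
  refine (norm_add_le _ _).trans (add_le_add (le_functionalGauge φ ?_) (le_functionalGauge φ ?_))
  · rwa [modulus_ofReal]
  · rwa [modulus_ofReal]

theorem functionalGauge_smul_le {c : ℝ} (hc : 0 < c) {x : E} (hx : 0 ≤ x) :
    c * functionalGauge φ x ≤ functionalGauge φ (c • x) := by
  rw [← le_div_iff₀' hc]
  refine functionalGauge_le φ hx fun w hw => ?_
  rw [le_div_iff₀' hc]
  have h : modulus ((c : ℂ) • w) ≤ c • x := by
    refine (modulus_smul_le _ _).trans ?_
    rw [Complex.norm_real, Real.norm_of_nonneg hc.le]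
    exact smul_le_smul_of_nonneg_left hw hc.le
  have h2 := le_functionalGauge φ h
  rwa [map_smul, norm_smul, Complex.norm_real, Real.norm_of_nonneg hc.le] at h2

/-- The gauge increases along orbits because `‖φ w‖ = ‖φ (T w)‖` and `|T w| ≤ S |w|`. -/
theorem isGauge_functionalGauge (hT : IsPositiveOperator T) {lam : ℂ} (hlam : ‖lam‖ = 1)
    (hφ : ∀ w, φ (T w) = lam * φ w) : IsGauge (realPart T) (functionalGauge φ) where
  nonneg := fun {x} hx => (norm_nonneg (φ 0)).trans (le_functionalGauge φ (by
    have : modulus (0 : Complexification E) ≤ 0 := by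
      simpa using modulus_smul_le (0 : ℂ) (0 : Complexification E)
    exact this.trans hx))
  mono := fun {x y} hx hxy => functionalGauge_le φ hx fun w hw =>
    le_functionalGauge φ (hw.trans hxy)
  superadd := fun {x y} hx hy => by
    rw [← le_sub_iff_add_le]
    refine functionalGauge_le φ hx fun w hw => ?_
    rw [le_sub_comm]
    refine functionalGauge_le φ hy fun w' hw' => ?_
    rw [le_sub_iff_add_le]
    -- Unimodular factors align the two values of `φ`, so that their norms add up, without changing
    -- the moduli of `w` and `w'`.
    obtain ⟨c, hc, hcw⟩ := RCLike.exists_norm_eq_mul_self (φ w)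
    obtain ⟨c', hc', hcw'⟩ := RCLike.exists_norm_eq_mul_self (φ w')
    have h1 : modulus (c • w + c' • w') ≤ x + y := by
      refine (modulus_add_le _ _).trans (add_le_add ?_ ?_)
      · rwa [modulus_smul_of_norm_eq_one hc]
      · rwa [modulus_smul_of_norm_eq_one hc']
    have h2 := le_functionalGauge φ h1
    rw [map_add, map_smul, map_smul, smul_eq_mul, smul_eq_mul, ← hcw, ← hcw'] at h2
    have h3 : ((‖φ w‖ : ℂ) + (‖φ w'‖ : ℂ)) = ((‖φ w'‖ + ‖φ w‖ : ℝ) : ℂ) := by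
      push_cast; ring
    refine le_trans (le_of_eq ?_) h2
    change _ = ‖((‖φ w‖ : ℂ) + (‖φ w'‖ : ℂ))‖
    rw [h3, Complex.norm_real, Real.norm_of_nonneg (by positivity)]
  subadd := fun {x y} hx hy => functionalGauge_le φ (add_nonneg hx hy) fun w hw => by
    -- The Riesz decomposition is applied to real and imaginary parts separately; this costs the
    -- factor `2` in `subadd`.
    have h : w = ⟨w.re, 0⟩ + Complex.I • ⟨w.im, 0⟩ := by ext <;> simp
    have h1 := norm_apply_ofReal_le φ hx hy ((abs_re_le_modulus w).trans hw)
    have h2 := norm_apply_ofReal_le φ hx hy ((abs_im_le_modulus w).trans hw)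
    rw [h, map_add, map_smul]
    refine (norm_add_le _ _).trans ?_
    rw [norm_smul, Complex.norm_I, one_mul]
    linarith
  smul := fun {c x} hc hx => by
    rcases hc.eq_or_lt with rfl | hc
    · rw [zero_smul, zero_mul]
      refine le_antisymm (functionalGauge_le φ le_rfl fun w hw => ?_)
        ((norm_nonneg (φ 0)).trans (le_functionalGauge φ (by
          simpa using modulus_smul_le (0 : ℂ) (0 : Complexification E))))
      simpa using norm_le_of_modulus_le φ hw
    · refine le_antisymm ?_ (functionalGauge_smul_le φ hc hx)
      have h := functionalGauge_smul_le φ (inv_pos.2 hc) (smul_nonneg hc.le hx)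
      rwa [smul_smul, inv_mul_cancel₀ hc.ne', one_smul, inv_mul_le_iff₀ hc] at h
  bound := ⟨‖φ‖, fun {x} hx => functionalGauge_le φ hx fun w hw => norm_le_of_modulus_le φ hw⟩
  le_apply := fun {x} hx => functionalGauge_le φ hx fun w hw => by
    have h := le_functionalGauge φ ((hT.modulus_apply_le w).trans (hT.realPart_mono hw))
    rwa [hφ, norm_mul, hlam, one_mul] at h

end functionalGauge

theorem realPart_resolvent_apply_sub {s : ℝ} (hs : (s : ℂ) ∈ resolventSet ℂ T)
    (hT : IsPositiveOperator T) (x : E) :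
    realPart (resolvent T (s : ℂ)) (s • x - realPart T x) = x := by
  have h := congrArg re (resolvent_apply_sub T hs ⟨x, 0⟩)
  rw [hT.apply_eq, ofReal_smul_eq] at h
  rw [realPart_apply]
  have h2 : (⟨s • x - realPart T x, 0⟩ : Complexification E) =
      ⟨s • x, s • (0 : E)⟩ - ⟨realPart T x, realPart T 0⟩ := by ext <;> simp
  rw [h2]
  exact h

theorem sub_realPart_apply_resolvent {s : ℝ} (hs : (s : ℂ) ∈ resolventSet ℂ T)
    (hT : IsPositiveOperator T) (x : E) :
    s • realPart (resolvent T (s : ℂ)) x - realPart T (realPart (resolvent T (s : ℂ)) x) =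
      x := by
  have h := congrArg re (sub_apply_resolvent T hs ⟨x, 0⟩)
  rw [hT.apply_eq, ofReal_smul_eq] at h
  exact h

/-- Weak limits of `(s - 1)² R(s)' χ` along a sequence with quadratic resolvent growth. -/
theorem IsPositiveOperator.exists_invariant_functional (hT : IsPositiveOperator T)
    (hr : spectralRadius ℂ T = 1) {s : ℕ → ℝ} (hs1 : ∀ n, 1 < s n)
    (hs : Tendsto s atTop (𝓝 1)) {C : ℝ}
    (hC : ∀ n, (s n - 1) ^ 2 * ‖resolvent T (s n : ℂ)‖ ≤ C) {χ : E →L[ℝ] ℝ}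
    (hχ : ∀ x, 0 ≤ x → 0 ≤ χ x) :
    ∃ ψ : E →L[ℝ] ℝ, (∀ x, 0 ≤ x → 0 ≤ ψ x) ∧ (∀ x, ψ (realPart T x) = ψ x) ∧
      ∃ F : Ultrafilter ℕ, (F : Filter ℕ) ≤ atTop ∧ ∀ x, Tendsto
        (fun n => (s n - 1) ^ 2 * χ (realPart (resolvent T (s n : ℂ)) x)) F (𝓝 (ψ x)) := by
  let g : ℕ → StrongDual ℝ E := fun n =>
    (s n - 1) ^ 2 • χ.comp (realPart (resolvent T (s n : ℂ)))
  have hg : ∀ n, ‖g n‖ ≤ ‖χ‖ * C := fun n => by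
    have h1 : ‖χ.comp (realPart (resolvent T (s n : ℂ)))‖ ≤ ‖χ‖ * ‖resolvent T (s n : ℂ)‖ :=
      (χ.opNorm_comp_le _).trans
        (mul_le_mul_of_nonneg_left (norm_realPart_le _) (norm_nonneg χ))
    calc ‖g n‖ ≤ (s n - 1) ^ 2 * ‖χ.comp (realPart (resolvent T (s n : ℂ)))‖ := by
          rw [← Real.norm_of_nonneg (sq_nonneg (s n - 1))]
          exact norm_smul_le ((s n - 1) ^ 2) (χ.comp (realPart (resolvent T (s n : ℂ))))
      _ ≤ (s n - 1) ^ 2 * (‖χ‖ * ‖resolvent T (s n : ℂ)‖) :=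
          mul_le_mul_of_nonneg_left h1 (sq_nonneg _)
      _ = ‖χ‖ * ((s n - 1) ^ 2 * ‖resolvent T (s n : ℂ)‖) := by ring
      _ ≤ ‖χ‖ * C := mul_le_mul_of_nonneg_left (hC n) (norm_nonneg χ)
  have hF : ((hyperfilter ℕ : Ultrafilter ℕ) : Filter ℕ) ≤ atTop := by
    rw [← Nat.cofinite_eq_atTop]
    exact hyperfilter_le_cofinite
  let f : ℕ → WeakDual ℝ E := fun n => StrongDual.toWeakDual (g n)
  have hmem : ∀ n, f n ∈ WeakDual.toStrongDual ⁻¹'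
      Metric.closedBall (0 : StrongDual ℝ E) (‖χ‖ * C) := fun n =>
    mem_closedBall_zero_iff.2 (hg n)
  -- Banach–Alaoglu. The limit is taken along an ultrafilter because the weak* compact ball need not
  -- be sequentially compact.
  obtain ⟨ψ, -, hψ⟩ := isCompact_iff_ultrafilter_le_nhds.1
    (WeakDual.isCompact_closedBall (𝕜 := ℝ) (0 : StrongDual ℝ E) (‖χ‖ * C))
    ((hyperfilter ℕ).map f)
    (le_principal_iff.2 (Ultrafilter.mem_map.2 (Filter.univ_mem' hmem)))
  have hlim : ∀ x, Tendsto
      (fun n => (s n - 1) ^ 2 * χ (realPart (resolvent T (s n : ℂ)) x))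
      ((hyperfilter ℕ : Ultrafilter ℕ) : Filter ℕ) (𝓝 (ψ x)) := fun x =>
    ((WeakDual.eval_continuous x).tendsto ψ).comp hψ
  refine ⟨WeakDual.toStrongDual ψ, fun x hx => ?_, fun x => ?_, hyperfilter ℕ, hF, hlim⟩
  · exact ge_of_tendsto' (hlim x) fun n => mul_nonneg (sq_nonneg _)
      (hχ _ (hT.realPart_resolvent_nonneg hr (hs1 n) hx))
  · have hsF := hs.mono_left hF
    -- Invariance comes from `R(s) S x = s R(s) x - x`: after multiplication by `(s - 1)²` the last
    -- term vanishes in the limit and the factor `s` tends to `1`.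
    have h1 : Tendsto (fun n => s n * ((s n - 1) ^ 2 *
        χ (realPart (resolvent T (s n : ℂ)) x)) - (s n - 1) ^ 2 * χ x)
        ((hyperfilter ℕ : Ultrafilter ℕ) : Filter ℕ) (𝓝 (1 * ψ x - (1 - 1) ^ 2 * χ x)) :=
      (hsF.mul (hlim x)).sub (((hsF.sub_const 1).pow 2).mul_const _)
    refine tendsto_nhds_unique (hlim (realPart T x)) ?_
    have h2 : (1 : ℝ) * ψ x - (1 - 1) ^ 2 * χ x = ψ x := by ring
    rw [h2] at h1
    refine h1.congr fun n => ?_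
    have hρ : (s n : ℂ) ∈ resolventSet ℂ T := spectrum.mem_resolventSet_of_spectralRadius_lt
      (spectralRadius_lt_of_one_lt hr (by
        rw [Complex.norm_real]; exact (hs1 n).trans_le (le_abs_self _)))
    have h3 := congrArg χ (realPart_resolvent_apply_sub hρ hT x)
    rw [map_sub, map_sub, map_smul, map_smul, smul_eq_mul] at h3
    rw [← h3]
    ring

end Complexification

/-! ### Leading Laurent coefficients at a pole -/

/-- A pole of the resolvent of order `p`, with `g(μ) = (μ - λ)^p R(μ, T)` near `λ`. -/
structure IsResolventPoleWith {X : Type*} [NormedAddCommGroup X] [NormedSpace ℂ X]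
    (T : X →L[ℂ] X) (lam : ℂ) (p : ℕ) (g : ℂ → X →L[ℂ] X) : Prop where
  pos : p ≠ 0
  differentiableAt : DifferentiableAt ℂ g lam
  ne_zero : g lam ≠ 0
  mem_resolventSet : ∀ᶠ μ in 𝓝[≠] lam, μ ∈ resolventSet ℂ T
  eq : ∀ᶠ μ in 𝓝[≠] lam, g μ = (μ - lam) ^ p • resolvent T μ

theorem IsPoleOfResolvent.exists_isResolventPoleWith {X : Type*} [NormedAddCommGroup X]
    [NormedSpace ℂ X] {T : X →L[ℂ] X} {lam : ℂ} (h : IsPoleOfResolvent T lam) :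
    ∃ p g, IsResolventPoleWith T lam p g := by
  obtain ⟨h1, h2, h3⟩ := h
  obtain ⟨n, hn⟩ := WithTop.ne_top_iff_exists.1 h3.ne_top
  rw [← hn] at h3
  have hn0 : n < 0 := by exact_mod_cast h3
  obtain ⟨g, hg, hg0, hge⟩ := (meromorphicOrderAt_eq_int_iff h2).1 hn.symm
  refine ⟨(-n).toNat, g, by omega, hg.differentiableAt, hg0, h1, ?_⟩
  filter_upwards [hge, self_mem_nhdsWithin] with μ hμ hne
  have hne' : μ - lam ≠ 0 := sub_ne_zero.2 hne
  have hz : (μ - lam) ^ (-n).toNat = (μ - lam) ^ (-n) := by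
    rw [← zpow_natCast, Int.toNat_of_nonneg (by omega)]
  rw [hμ, hz, smul_smul, ← zpow_add₀ hne', neg_add_cancel, zpow_zero, one_smul]

namespace IsResolventPoleWith

variable {X : Type*} [NormedAddCommGroup X] [NormedSpace ℂ X] {T : X →L[ℂ] X} {lam : ℂ} {p : ℕ}
  {g : ℂ → X →L[ℂ] X} (h : IsResolventPoleWith T lam p g)
include h

theorem hasDerivAt_apply (x : X) : HasDerivAt (fun μ => g μ x) (deriv g lam x) lam := by
  have h1 := (ContinuousLinearMap.apply ℂ X x).hasFDerivAt.comp_hasDerivAt lam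
    h.differentiableAt.hasDerivAt
  exact h1

theorem eventually_sub_apply (x : X) :
    ∀ᶠ μ in 𝓝[≠] lam, μ • g μ x - T (g μ x) = (μ - lam) ^ p • x := by
  filter_upwards [h.mem_resolventSet, h.eq] with μ h1 h2
  rw [h2]
  have h3 := sub_apply_resolvent T h1 x
  change μ • (μ - lam) ^ p • resolvent T μ x - T ((μ - lam) ^ p • resolvent T μ x) = _
  rw [map_smul, smul_comm, ← smul_sub, h3]

theorem eventually_apply_sub (x : X) :
    ∀ᶠ μ in 𝓝[≠] lam, g μ (μ • x - T x) = (μ - lam) ^ p • x := by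
  filter_upwards [h.mem_resolventSet, h.eq] with μ h1 h2
  rw [h2]
  change (μ - lam) ^ p • resolvent T μ (μ • x - T x) = _
  rw [resolvent_apply_sub T h1 x]

theorem tendsto_apply (x : X) : Tendsto (fun μ => g μ x) (𝓝[≠] lam) (𝓝 (g lam x)) :=
  (h.hasDerivAt_apply x).continuousAt.tendsto.mono_left nhdsWithin_le_nhds

theorem tendsto_pow_sub (x : X) {n : ℕ} (hn : n ≠ 0) :
    Tendsto (fun μ : ℂ => (μ - lam) ^ n • x) (𝓝[≠] lam) (𝓝 0) := by
  have h1 : Continuous fun μ : ℂ => (μ - lam) ^ n • x := by fun_prop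
  have h2 := (h1.tendsto lam).mono_left (nhdsWithin_le_nhds (s := {lam}ᶜ))
  simpa [hn] using h2

/-- The leading coefficient maps into the eigenspace. -/
theorem apply_leading (x : X) : T (g lam x) = lam • g lam x := by
  have hid : Tendsto (fun μ : ℂ => μ) (𝓝[≠] lam) (𝓝 lam) := nhdsWithin_le_nhds
  have h1 : Tendsto (fun μ => μ • g μ x - T (g μ x)) (𝓝[≠] lam)
      (𝓝 (lam • g lam x - T (g lam x))) :=
    (hid.smul (h.tendsto_apply x)).sub ((T.continuous.tendsto _).comp (h.tendsto_apply x))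
  have h2 := tendsto_nhds_unique ((h1.congr' (h.eventually_sub_apply x)))
    (h.tendsto_pow_sub x h.pos)
  exact (sub_eq_zero.1 h2).symm

theorem leading_apply (x : X) : g lam (T x) = lam • g lam x := by
  have hid : Tendsto (fun μ : ℂ => μ) (𝓝[≠] lam) (𝓝 lam) := nhdsWithin_le_nhds
  have h0 : Tendsto (fun μ => μ • g μ x - g μ (T x)) (𝓝[≠] lam)
      (𝓝 (lam • g lam x - g lam (T x))) :=
    (hid.smul (h.tendsto_apply x)).sub (h.tendsto_apply (T x))
  have h1 : ∀ᶠ μ in 𝓝[≠] lam, μ • g μ x - g μ (T x) = (μ - lam) ^ p • x := by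
    filter_upwards [h.eventually_apply_sub x] with μ hμ
    rwa [map_sub, map_smul] at hμ
  have h2 := tendsto_nhds_unique (h0.congr' h1) (h.tendsto_pow_sub x h.pos)
  exact (sub_eq_zero.1 h2).symm

/-- Applying `g lam` to `(μ - T) g(μ) x = (μ - lam)^p x` turns `T` into `lam`, and one factor `μ -
lam` cancels. The value at `lam` for `p = 1` makes the residue idempotent; the derivative for `p =
2` gives `leading_deriv`. -/
theorem eventually_leading_apply (x : X) :
    ∀ᶠ μ in 𝓝[≠] lam, g lam (g μ x) = (μ - lam) ^ (p - 1) • g lam x := by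
  filter_upwards [h.eventually_sub_apply x, self_mem_nhdsWithin] with μ h1 h2
  have hne : μ - lam ≠ 0 := sub_ne_zero.2 h2
  have h3 := congrArg (g lam) h1
  rw [map_sub, map_smul, map_smul, h.leading_apply, ← sub_smul] at h3
  have hp : (μ - lam) ^ p = (μ - lam) * (μ - lam) ^ (p - 1) := by
    rw [← pow_succ', Nat.sub_add_cancel (Nat.one_le_iff_ne_zero.2 h.pos)]
  rw [hp, mul_smul] at h3
  exact smul_right_injective X hne h3

theorem leading_leading (hp : p = 1) (x : X) : g lam (g lam x) = g lam x := by
  subst hp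
  have h1 : Tendsto (fun μ => g lam (g μ x)) (𝓝[≠] lam) (𝓝 (g lam (g lam x))) :=
    ((g lam).continuous.tendsto _).comp (h.tendsto_apply x)
  refine tendsto_nhds_unique h1 (tendsto_const_nhds.congr' ?_)
  filter_upwards [h.eventually_leading_apply x] with μ hμ
  simpa using hμ.symm

theorem eventuallyEq_nhds {f₁ f₂ : ℂ → X} (h1 : ContinuousAt f₁ lam) (h2 : ContinuousAt f₂ lam)
    (he : ∀ᶠ μ in 𝓝[≠] lam, f₁ μ = f₂ μ) : f₁ =ᶠ[𝓝 lam] f₂ :=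
  (h1.eventuallyEq_nhds_iff_eventuallyEq_nhdsNE h2).1 he

/-- For a pole of order two, the next coefficient is mapped to the leading one by `T - λ`. -/
theorem apply_deriv (hp : p = 2) (x : X) :
    T (deriv g lam x) - lam • deriv g lam x = g lam x := by
  subst hp
  have hd := h.hasDerivAt_apply x
  have h1 : HasDerivAt (fun μ => μ • g μ x - T (g μ x))
      ((lam • deriv g lam x + (1 : ℂ) • g lam x) - T (deriv g lam x)) lam :=
    -- Both sides of `(μ - T) g(μ) x = (μ - lam)² x` are differentiated at `lam`; the right side has
    -- derivative `0` there.
    ((hasDerivAt_id lam).smul hd).sub (T.hasFDerivAt.comp_hasDerivAt lam hd)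
  have h2 : HasDerivAt (fun μ : ℂ => (μ - lam) ^ 2 • x) ((0 : ℂ) • x) lam := by
    have h3 := (((hasDerivAt_id lam).sub_const lam).pow 2).smul_const x
    simpa using h3
  have he := h.eventuallyEq_nhds h1.continuousAt h2.continuousAt (h.eventually_sub_apply x)
  have h4 := h1.unique (h2.congr_of_eventuallyEq he)
  rw [zero_smul, one_smul, sub_eq_zero] at h4
  rw [← h4]
  abel

/-- For a pole of order two, the leading coefficient absorbs the next one. -/
theorem leading_deriv (hp : p = 2) (x : X) : g lam (deriv g lam x) = g lam x := by
  subst hp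
  have h1 : HasDerivAt (fun μ => g lam (g μ x)) (g lam (deriv g lam x)) lam :=
    (g lam).hasFDerivAt.comp_hasDerivAt lam (h.hasDerivAt_apply x)
  have h2 : HasDerivAt (fun μ : ℂ => (μ - lam) ^ (2 - 1) • g lam x) ((1 : ℂ) • g lam x) lam := by
    have h3 := ((hasDerivAt_id lam).sub_const lam).smul_const (g lam x)
    simpa using h3
  have he := h.eventuallyEq_nhds h1.continuousAt h2.continuousAt (h.eventually_leading_apply x)
  rw [h1.unique (h2.congr_of_eventuallyEq he), one_smul]

end IsResolventPoleWith

/-! ### Cyclicity for poles of order two and of order one -/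

theorem tendsto_ofReal_mul_nhdsNE {lam : ℂ} (hlam : ‖lam‖ = 1) {s : ℕ → ℝ} (hs1 : ∀ n, 1 < s n)
    (hs : Tendsto s atTop (𝓝 1)) : Tendsto (fun n => (s n : ℂ) * lam) atTop (𝓝[≠] lam) := by
  refine tendsto_nhdsWithin_iff.2 ⟨?_, Eventually.of_forall fun n hn => ?_⟩
  · have h := ((Complex.continuous_ofReal.tendsto 1).comp hs).mul_const lam
    simpa using h
  · have h2 := congrArg norm hn
    rw [norm_mul, hlam, mul_one, Complex.norm_real, Real.norm_of_nonneg (by linarith [hs1 n])]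
      at h2
    exact (hs1 n).ne' h2

theorem norm_ofReal_mul_sub {lam : ℂ} (hlam : ‖lam‖ = 1) {t : ℝ} (ht : 1 < t) :
    ‖(t : ℂ) * lam - lam‖ = t - 1 := by
  have h : (t : ℂ) * lam - lam = ((t - 1 : ℝ) : ℂ) * lam := by push_cast; ring
  rw [h, norm_mul, hlam, mul_one, Complex.norm_real, Real.norm_of_nonneg (by linarith)]

namespace Complexification

variable {E : Type*} [NormedAddCommGroup E] [Lattice E] [HasSolidNorm E] [IsOrderedAddMonoid E]
  [NormedSpace ℝ E] [IsOrderedModule ℝ E] [CompleteSpace E]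
  {T : Complexification E →L[ℂ] Complexification E} {lam : ℂ} {p : ℕ}
  {g : ℂ → Complexification E →L[ℂ] Complexification E}

/-- Quadratic growth of the resolvent bounds the order of a peripheral pole by two. -/
theorem IsPositiveOperator.pole_order_le_two (hT : IsPositiveOperator T)
    (hr : spectralRadius ℂ T = 1) (hlam : ‖lam‖ = 1) (hg : IsResolventPoleWith T lam p g)
    {s : ℕ → ℝ} (hs1 : ∀ n, 1 < s n) (hs : Tendsto s atTop (𝓝 1)) {C : ℝ}
    (hC : ∀ n, (s n - 1) ^ 2 * ‖resolvent T (s n : ℂ)‖ ≤ C) : p ≤ 2 := by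
  by_contra hp
  rw [not_le] at hp
  have hμ := tendsto_ofReal_mul_nhdsNE hlam hs1 hs
  refine hg.ne_zero (norm_eq_zero.1 ?_)
  have h1 : Tendsto (fun n => ‖g ((s n : ℂ) * lam)‖) atTop (𝓝 ‖g lam‖) :=
    ((hg.differentiableAt.continuousAt.tendsto.mono_left nhdsWithin_le_nhds).comp hμ).norm
  -- For `p > 2` a positive power of `s n - 1` is left over, which would force the leading
  -- coefficient to vanish.
  have h2 : Tendsto (fun n => (s n - 1) ^ (p - 2) * C) atTop (𝓝 0) := by
    have h3 := ((hs.sub_const 1).pow (p - 2)).mul_const C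
    rwa [sub_self, zero_pow (by omega), zero_mul] at h3
  refine tendsto_nhds_unique h1 (squeeze_zero' (Eventually.of_forall fun n => norm_nonneg _) ?_ h2)
  filter_upwards [hμ.eventually hg.eq] with n hn
  have hpos : 0 < s n - 1 := sub_pos.2 (hs1 n)
  have hnorm : ‖(s n : ℂ) * lam‖ = s n := by
    rw [norm_mul, hlam, mul_one, Complex.norm_real, Real.norm_of_nonneg (by linarith)]
  rw [hn, norm_smul, norm_pow, norm_ofReal_mul_sub hlam (hs1 n)]
  calc (s n - 1) ^ p * ‖resolvent T ((s n : ℂ) * lam)‖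
      ≤ (s n - 1) ^ p * ‖resolvent T (s n : ℂ)‖ :=
        mul_le_mul_of_nonneg_left (hT.norm_resolvent_le hr (hs1 n) hnorm) (by positivity)
    _ = (s n - 1) ^ (p - 2) * ((s n - 1) ^ 2 * ‖resolvent T (s n : ℂ)‖) := by
        rw [← mul_assoc, ← pow_add, Nat.sub_add_cancel hp.le]
    _ ≤ (s n - 1) ^ (p - 2) * C := mul_le_mul_of_nonneg_left (hC n) (by positivity)

theorem modulus_pole_le (hT : IsPositiveOperator T)
    (hr : spectralRadius ℂ T = 1) (hlam : ‖lam‖ = 1) {t : ℝ} (ht : 1 < t)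
    (heq : g ((t : ℂ) * lam) = ((t : ℂ) * lam - lam) ^ p • resolvent T ((t : ℂ) * lam))
    (x : Complexification E) :
    modulus (g ((t : ℂ) * lam) x) ≤
      (t - 1) ^ p • realPart (resolvent T (t : ℂ)) (modulus x) := by
  have hnorm : ‖(t : ℂ) * lam‖ = t := by
    rw [norm_mul, hlam, mul_one, Complex.norm_real, Real.norm_of_nonneg (by linarith)]
  rw [heq]
  refine (modulus_smul_le _ _).trans ?_
  rw [norm_pow, norm_ofReal_mul_sub hlam ht]
  exact smul_le_smul_of_nonneg_left (hT.modulus_resolvent_le hr ht hnorm x)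
    (pow_nonneg (by linarith) p)

theorem mem_resolventSet_of_one_lt (hr : spectralRadius ℂ T = 1) {t : ℝ} (ht : 1 < t) :
    (t : ℂ) ∈ resolventSet ℂ T :=
  spectrum.mem_resolventSet_of_spectralRadius_lt (spectralRadius_lt_of_one_lt hr (by
    rw [Complex.norm_real]; exact ht.trans_le (le_abs_self _)))

/-- The invariant functional `ψ` vanishes on the moduli of the range of the leading coefficient, but
not on `|z|` for `z = deriv g lam y`. Since `T z - lam • z = g lam y`, this `z` is an eigenvector
modulo the null ideal of `ψ`. -/
theorem IsPositiveOperator.zpow_mem_spectrum_of_order_two (hT : IsPositiveOperator T)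
    (hr : spectralRadius ℂ T = 1) (hlam : ‖lam‖ = 1) (hg : IsResolventPoleWith T lam 2 g)
    {s : ℕ → ℝ} (hs1 : ∀ n, 1 < s n) (hs : Tendsto s atTop (𝓝 1)) {C : ℝ}
    (hC : ∀ n, (s n - 1) ^ 2 * ‖resolvent T (s n : ℂ)‖ ≤ C) (k : ℤ) :
    lam ^ k ∈ spectrum ℂ T := by
  obtain ⟨y, hy⟩ : ∃ y, g lam y ≠ 0 := by
    by_contra! h
    exact hg.ne_zero (ContinuousLinearMap.ext h)
  obtain ⟨χ, hχ0, hχ⟩ := exists_positive_functional_pos (modulus_nonneg (g lam y))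
    (modulus_ne_zero hy)
  obtain ⟨ψ, hψ0, hψS, F, hF, hlim⟩ := hT.exists_invariant_functional hr hs1 hs hC hχ0
  have hμ := (tendsto_ofReal_mul_nhdsNE hlam hs1 hs).mono_left hF
  have hlimg : ∀ (η : E →L[ℝ] ℝ) x, Tendsto (fun n => η (modulus (g ((s n : ℂ) * lam) x))) F
      (𝓝 (η (modulus (g lam x)))) := fun η x =>
    ((η.continuous.comp continuous_modulus).tendsto _).comp ((hg.tendsto_apply x).comp hμ)
  have hmono : ∀ (η : E →L[ℝ] ℝ), (∀ x, 0 ≤ x → 0 ≤ η x) → ∀ {a b : E}, a ≤ b → η a ≤ η b := by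
    intro η hη a b hab
    have h := hη _ (sub_nonneg.2 hab)
    rwa [map_sub, sub_nonneg] at h
  -- The order `2` of the pole matches the factor `(s n - 1)²` in the definition of `ψ`.
  have hdom : ∀ x, χ (modulus (g lam x)) ≤ ψ (modulus x) := fun x => by
    refine le_of_tendsto_of_tendsto (hlimg χ x) (hlim (modulus x)) ?_
    filter_upwards [hμ.eventually hg.eq] with n hn
    have h := hmono χ hχ0 (modulus_pole_le hT hr hlam (hs1 n) hn x)
    rwa [map_smul, smul_eq_mul] at h
  -- Invariance gives `ψ (R(s) x) = ψ x / (s - 1)`, only a simple singularity, so multiplication by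
  -- `(s - 1)²` leaves a quantity tending to `0`.
  have hnull : ∀ x, ψ (modulus (g lam x)) = 0 := fun x => by
    refine le_antisymm ?_ (hψ0 _ (modulus_nonneg _))
    have hsF := hs.mono_left hF
    have hz : Tendsto (fun n => (s n - 1) * ψ (modulus x)) F (𝓝 0) := by
      have h := (hsF.sub_const 1).mul_const (ψ (modulus x))
      rwa [sub_self, zero_mul] at h
    refine le_of_tendsto_of_tendsto (hlimg ψ x) hz ?_
    filter_upwards [hμ.eventually hg.eq] with n hn
    have h := hmono ψ hψ0 (modulus_pole_le hT hr hlam (hs1 n) hn x)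
    rw [map_smul, smul_eq_mul] at h
    refine h.trans_eq ?_
    have h2 := congrArg ψ (sub_realPart_apply_resolvent
      (mem_resolventSet_of_one_lt hr (hs1 n)) hT (modulus x))
    rw [map_sub, map_smul, hψS, smul_eq_mul] at h2
    rw [← h2]
    ring
  have hq := isGauge_of_functional hψ0 hψS
  have hpow : ∀ n x, ψ ((realPart T ^ n) x) = ψ x := fun n x => by
    induction n with
    | zero => rfl
    | succ n ih =>
      rw [pow_succ']
      exact (hψS _).trans ih
  refine hq.zpow_mem_spectrum hT hr hlam (z := deriv g lam y) (K := ψ (modulus (deriv g lam y)))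
    ?_ ?_ (fun n => (hpow n _).le) k
  · rw [hg.apply_deriv rfl]
    have hmod : modulus (g lam y) ∈ IsGauge.nullIdeal hT hq := fun n => by
      rw [hpow, abs_of_nonneg (modulus_nonneg _), hnull]
    have hI := IsGauge.isClosedIdeal_nullIdeal hT hq
    exact ⟨hI.mem_of_abs_le (abs_re_le_modulus _) hmod,
      hI.mem_of_abs_le (abs_im_le_modulus _) hmod⟩
  · have h := hdom (deriv g lam y)
    rw [hg.leading_deriv rfl] at h
    exact (hχ.trans_le h).ne'

/-- Linear growth of a functional along an orbit forces quadratic growth of the resolvent. -/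
theorem IsPositiveOperator.le_sq_mul_resolvent (hT : IsPositiveOperator T)
    (hr : spectralRadius ℂ T = 1) {χ : E →L[ℝ] ℝ} {u : E} {ε b : ℝ}
    (h : ∀ n : ℕ, ε * n - b ≤ χ ((realPart T ^ n) u)) {t : ℝ} (ht : 1 < t) :
    ε - b * (t - 1) ≤ (t - 1) ^ 2 * χ (realPart (resolvent T (t : ℂ)) u) := by
  have ht0 : 0 < t := by linarith
  have h1 := ((hT.hasSum_realPart_resolvent hr ht u).mapL χ)
  have hnorm : ‖t⁻¹‖ < 1 := by
    rw [norm_inv, Real.norm_of_nonneg ht0.le]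
    exact inv_lt_one_of_one_lt₀ ht
  -- The comparison series `∑ (ε n - b) t^{-(n+1)}` sums to `ε / (t - 1)² - b / (t - 1)`.
  have h2 := (((hasSum_coe_mul_geometric_of_norm_lt_one hnorm).mul_left ε).sub
    ((hasSum_geometric_of_norm_lt_one hnorm).mul_left b)).mul_left t⁻¹
  have h3 := hasSum_le (fun n => ?_) h2 h1
  · have h4 := mul_le_mul_of_nonneg_left h3 (sq_nonneg (t - 1))
    refine le_trans (le_of_eq ?_) h4
    have ht1 : t - 1 ≠ 0 := by linarith
    have ht2 : 1 - t⁻¹ = (t - 1) / t := by field_simp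
    rw [ht2]
    field_simp
  · rw [map_smul, smul_eq_mul, pow_succ']
    have h5 : t⁻¹ * (ε * (n * t⁻¹ ^ n) - b * t⁻¹ ^ n) = t⁻¹ * t⁻¹ ^ n * (ε * n - b) := by ring
    rw [h5]
    exact mul_le_mul_of_nonneg_left (h n) (by positivity)

/-- The residue supplies an eigenvector `z` and an eigenfunctional `φ` with `φ z ≠ 0`, so the
modulus of `φ` is a gauge not vanishing at `u = |z|`. It settles the matter unless it grows along
the orbit of `u`; growth is at least linear and produces an invariant functional positive at `u`. -/
theorem IsPositiveOperator.zpow_mem_spectrum_of_order_one (hT : IsPositiveOperator T)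
    (hr : spectralRadius ℂ T = 1) (hlam : ‖lam‖ = 1) (hg : IsResolventPoleWith T lam 1 g)
    {s : ℕ → ℝ} (hs1 : ∀ n, 1 < s n) (hs : Tendsto s atTop (𝓝 1)) {C : ℝ}
    (hC : ∀ n, (s n - 1) ^ 2 * ‖resolvent T (s n : ℂ)‖ ≤ C) (k : ℤ) :
    lam ^ k ∈ spectrum ℂ T := by
  obtain ⟨y, hy⟩ : ∃ y, g lam y ≠ 0 := by
    by_contra! h
    exact hg.ne_zero (ContinuousLinearMap.ext h)
  set z := g lam y with hz
  have hTz : T z = lam • z := hg.apply_leading y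
  obtain ⟨ξ, -, hξ⟩ := exists_dual_vector ℂ z (norm_ne_zero_iff.2 hy)
  set φ : Complexification E →L[ℂ] ℂ := ξ.comp (g lam) with hφdef
  have hφz : φ z ≠ 0 := by
    change ξ (g lam (g lam y)) ≠ 0
    rw [hg.leading_leading rfl, ← hz, hξ]
    simpa using hy
  have hφ : ∀ w, φ (T w) = lam * φ w := fun w => by
    change ξ (g lam (T w)) = lam * ξ (g lam w)
    rw [hg.leading_apply, map_smul, smul_eq_mul]
  have hq := isGauge_functionalGauge φ hT hlam hφ
  set q := functionalGauge φ with hqdef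
  set u := modulus z with hu
  have hu0 : 0 ≤ u := modulus_nonneg z
  have hqu : 0 < q u := (norm_pos_iff.2 hφz).trans_le (le_functionalGauge φ le_rfl)
  set d := realPart T u - u with hd
  have hd0 : 0 ≤ d := by
    have h := hT.modulus_le_of_eigen hlam z
    have h0 : modulus (T z - lam • z) = 0 := by
      rw [hTz, sub_self, ← norm_eq_zero, norm_modulus, norm_zero]
    rw [h0, add_zero] at h
    exact sub_nonneg.2 h
  have hstep : ∀ n, (realPart T ^ (n + 1)) u = (realPart T ^ n) u + (realPart T ^ n) d := by
    intro n
    rw [hd, map_sub, pow_succ]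
    change (realPart T ^ n) (realPart T u) = _
    abel
  -- The orbit of `u` increases by `S^n d`. If the gauge ignores all these increments, it is bounded
  -- on the orbit.
  by_cases hall : ∀ j, q ((realPart T ^ j) d) = 0
  · refine hq.zpow_mem_spectrum hT hr hlam (z := z) (K := 2 * q u) ?_ hqu.ne' ?_ k
    · rw [hTz, sub_self]
      exact Submodule.zero_mem _
    · intro n
      have hdN : d ∈ IsGauge.nullIdeal hT hq := fun j => by rw [abs_of_nonneg hd0, hall]
      have hsum : (realPart T ^ n) u = u + ∑ i ∈ Finset.range n, (realPart T ^ i) d := by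
        induction n with
        | zero => simp
        | succ n ih => rw [hstep, ih, Finset.sum_range_succ, add_assoc]
      have hs0 : 0 ≤ ∑ i ∈ Finset.range n, (realPart T ^ i) d :=
        Finset.sum_nonneg fun i _ => hT.realPart_pow_nonneg i hd0
      have hsN : ∑ i ∈ Finset.range n, (realPart T ^ i) d ∈ IsGauge.nullIdeal hT hq :=
        Submodule.sum_mem _ fun i _ => IsGauge.pow_apply_mem_nullIdeal hT hq hdN i
      rw [hsum]
      refine (hq.subadd hu0 hs0).trans_eq ?_
      rw [IsGauge.gauge_eq_zero hT hq hs0 hsN, add_zero]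
  · push Not at hall
    obtain ⟨j, hj⟩ := hall
    have hqj : 0 < q ((realPart T ^ j) d) :=
      lt_of_le_of_ne (hq.nonneg (hT.realPart_pow_nonneg j hd0)) (Ne.symm hj)
    obtain ⟨χ, hχ0, ε, hε, hχq⟩ := hq.exists_functional hu0 hqu
    set δ := ε * q ((realPart T ^ j) d) with hδ
    have hδ0 : 0 < δ := mul_pos hε hqj
    -- From index `j` on, each increment contributes at least `ε q (S^n d) ≥ δ`; before that the
    -- asserted lower bound is not positive.
    have hgrow : ∀ n : ℕ, δ * n - δ * j ≤ χ ((realPart T ^ n) u) := by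
      intro n
      induction n with
      | zero =>
        have h1 : 0 ≤ χ ((realPart T ^ 0) u) := hχ0 _ (hT.realPart_pow_nonneg 0 hu0)
        have h2 : 0 ≤ δ * j := by positivity
        simpa using le_trans (by linarith) h1
      | succ n ih =>
        rw [hstep, map_add]
        have hn0 := hT.realPart_pow_nonneg n hd0
        rcases le_or_gt j n with hjn | hjn
        · have h1 := hχq _ hn0
          have h2 := mul_le_mul_of_nonneg_left (IsGauge.le_pow_apply hT hq hd0 hjn) hε.le
          rw [Nat.cast_succ]
          linarith
        · have h1 : 0 ≤ χ ((realPart T ^ n) u) := hχ0 _ (hT.realPart_pow_nonneg n hu0)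
          have h2 := hχ0 _ hn0
          have h3 : ((n + 1 : ℕ) : ℝ) ≤ j := by exact_mod_cast hjn
          have h4 := mul_le_mul_of_nonneg_left h3 hδ0.le
          linarith
    obtain ⟨ψ, hψ0, hψS, F, hF, hlim⟩ := hT.exists_invariant_functional hr hs1 hs hC hχ0
    have hψu : δ ≤ ψ u := by
      have h1 : Tendsto (fun n => δ - δ * j * (s n - 1)) F (𝓝 δ) := by
        have h := (((hs.mono_left hF).sub_const 1).const_mul (δ * j)).const_sub δ
        simpa using h
      exact le_of_tendsto_of_tendsto' h1 (hlim u) fun n => hT.le_sq_mul_resolvent hr hgrow (hs1 n)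
    have hpow : ∀ n x, ψ ((realPart T ^ n) x) = ψ x := fun n x => by
      induction n with
      | zero => rfl
      | succ n ih =>
        rw [pow_succ']
        exact (hψS _).trans ih
    -- The gauge `ψ` is constant on the orbit of `u`, hence bounded there, and `z` is a true
    -- eigenvector.
    refine (isGauge_of_functional hψ0 hψS).zpow_mem_spectrum hT hr hlam (z := z) (K := ψ u) ?_
      (hδ0.trans_le hψu).ne' (fun n => (hpow n u).le) k
    rw [hTz, sub_self]
    exact Submodule.zero_mem _

end Complexification

/-! ### The main theorem -/

theorem mainTheorem8 {E : Type*} [NormedAddCommGroup E] [Lattice E] [HasSolidNorm E]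
    [IsOrderedAddMonoid E] [NormedSpace ℝ E] [IsOrderedModule ℝ E] [CompleteSpace E]
    (T : Complexification E →L[ℂ] Complexification E)
    (hT : Complexification.IsPositiveOperator T)
    (hr : spectralRadius ℂ T = 1)
    (lam : ℂ) (hlam : lam ∈ peripheralSpectrum T) (hpole : IsPoleOfResolvent T lam)
    (r : ℕ → ℝ) (hr_gt : ∀ n, 1 < r n) (hr_anti : Antitone r) (hr_lim : Tendsto r atTop (𝓝 1))
    (hgrowth : (fun n => ‖resolvent T (r n : ℂ)‖) =O[atTop] fun n => 1 / (r n - 1) ^ 2) :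
    ∀ k : ℤ, lam ^ k ∈ peripheralSpectrum T := by
  have hnorm : ‖lam‖ = 1 := by
    have h := hlam.2
    rw [hr] at h
    rw [← coe_nnnorm, NNReal.coe_eq_one]
    exact_mod_cast h
  obtain ⟨C, hC⟩ := hgrowth.bound
  -- The bound holds only from some index on; shifting the sequence makes it hold throughout.
  obtain ⟨n₀, hn₀⟩ := eventually_atTop.1 hC
  have hs1 : ∀ n, 1 < r (n + n₀) := fun n => hr_gt _
  have hs : Tendsto (fun n => r (n + n₀)) atTop (𝓝 1) := (tendsto_add_atTop_iff_nat n₀).2 hr_lim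
  have hb : ∀ n, (r (n + n₀) - 1) ^ 2 * ‖resolvent T (r (n + n₀) : ℂ)‖ ≤ C := fun n => by
    have hpos : 0 < (r (n + n₀) - 1) ^ 2 := pow_pos (sub_pos.2 (hs1 n)) 2
    have h := hn₀ (n + n₀) (Nat.le_add_left n₀ n)
    rw [norm_norm, norm_div, norm_one, Real.norm_of_nonneg hpos.le, mul_one_div,
      le_div_iff₀ hpos] at h
    rwa [mul_comm]
  obtain ⟨p, g, hg⟩ := hpole.exists_isResolventPoleWith
  have hp := hT.pole_order_le_two hr hnorm hg hs1 hs hb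
  have hp0 := hg.pos
  intro k
  refine ⟨?_, ?_⟩
  · obtain rfl | rfl : p = 1 ∨ p = 2 := by omega
    · exact hT.zpow_mem_spectrum_of_order_one hr hnorm hg hs1 hs hb k
    · exact hT.zpow_mem_spectrum_of_order_two hr hnorm hg hs1 hs hb k
  · have h : ‖lam ^ k‖₊ = 1 := by
      rw [← NNReal.coe_inj, coe_nnnorm, norm_zpow, hnorm, one_zpow, NNReal.coe_one]
    rw [hr, h, ENNReal.coe_one]
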